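/- Let $k$ be a field and let $H$ be a finite group acting by automorphisms on a group $\Gamma$. Write $k^H$ for the algebra of functions $H\to k$, with idempotents $\delta_h$. The smash coproduct $k[\Gamma]\rtimes k^H$ is the Hopf algebra which is $k[\Gamma]\otimes k^H$ as an algebra (write $r\#f=r\otimes f$), with $$\Delta(r\#\delta_h)=\sum_{l\in H} r\#\delta_{l^{-1}}\otimes l.r\#\delta_{lh},\qquad \varepsilon(r\#\delta_h)=\delta_{h,1},\qquad S(r\#\delta_h)=h^{-1}.r^{-1}\#\delta_{h^{-1}}.$$ A quotient datum $(N,\Phi)$ consists of a normal $H$-stable subgroup $N$ of $\Gamma$ and a group morphism $\Phi:N\to(k^H)^\times$ with $\Phi(r)(lh)=\Phi(l^{-1}.r)(h)\,\Phi(r)(l)$ and $\Phi(r)=\Phi(srs^{-1})$ for all $r\in N$, $s\in\Gamma$, $h,l\in H$. Given such a datum, let $u:\Gamma\to\Gamma/N$ be the projection, let $j:\Gamma/N\to\Gamma$ be a section of $u$ with $j(1)=1$, and let $k[\Gamma/N]\rtimes_\Phi k^H$ be the Hopf algebra with underlying space $k[\Gamma/N]\otimes k^H$, unit $1\#1$,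 counit $\varepsilon(x\#\delta_h)=\delta_{h,1}$ and, for $x,y\in\Gamma/N$ and $g,h\in H$, $$(x\#\delta_h)(y\#\delta_g)=xy\#\delta_h\delta_g\,\Phi\big(j(x)j(y)j(xy)^{-1}\big),$$ $$\Delta(x\#\delta_h)=\sum_{l\in H}x\#\delta_{l^{-1}}\otimes l.x\#\delta_{lh}\,\Phi\big(l.j(x)\,j(l.x)^{-1}\big),$$ $$S(x\#\delta_h)=h^{-1}.x^{-1}\#\Phi\big(j(h^{-1}.x^{-1})^{-1}\,h^{-1}.j(x)^{-1}\big)\delta_{h^{-1}}.$$ For an algebra map $\rho:A\to R$ from a Hopf algebra $A$ to an algebra $R$, a factorization of $\rho$ is a triple $(L,q,\varphi)$ with $L$ a Hopf algebra, $q:A\to L$ a surjective Hopf algebra map and $\varphi:L\to R$ an algebra map such that $\rho=\varphi q$. The Hopf image of $\rho$ is the final factorization: a factorization $(A_\rho,p,\tilde\rho)$ such that for every factorization $(L,q,\varphi)$ there is a unique Hopf algebra map $f:L\to A_\rho$ with $fq=p$ and $\tilde\rho f=\varphi$. Let $R$ be a $k$-algebra and let $\rho:k[\Gamma]\rtimes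 k^H\to R$ be an algebra map whose restriction $f\mapsto\rho(1\#f)$ to $k^H$ is injective. Let $\mathcal E(\rho)$ be the set of quotient data $(N,\Phi)$ with $\rho(r\#1)=\rho(1\#\Phi(r))$ for all $r\in N$. Then: 1. The set $N_0=\{r\in\Gamma \mid \exists f\in k^H,\ \rho(r\#1)=\rho(1\#f)\}$ is a normal subgroup of $\Gamma$, and there is a unique group morphism $\Phi:N_0\to(k^H)^\times$ with $\rho(r\#1)=\rho(1\#\Phi(r))$ for all $r\in N_0$. 2. Put $$N=\{r\in N_0 \mid \forall g,h,l\in H,\ h.r\in N_0 \text{ and } \Phi(g.r)(lh)=\Phi\big((l^{-1}g).r\big)(h)\,\Phi(g.r)(l)\}.$$ Then $N$ is a normal and $H$-stable subgroup of $\Gamma$, and $(N,\Phi_{|N})\in\mathcal E(\rho)$. 3. The Hopf image of $\rho$ is isomorphic to $k[\Gamma/N]\rtimes_\Phi k^H$. More precisely, for every section $j$ as above there are a Hopf algebra map $q$ and an algebra map $\tilde\rho$ with $q(r\#f)=u(r)\#f\,\Phi\big(r\,j(u(r))^{-1}\big)$ and $\tilde\rho(x\#f)=\rho(j(x)\#f)$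 for $r\in\Gamma$, $x\in\Gamma/N$, $f\in k^H$, and $(k[\Gamma/N]\rtimes_\Phi k^H,\,q,\,\tilde\rho)$ is the Hopf image of $\rho$. -/

import Mathlib

open scoped TensorProduct

universe u v w x y

set_option linter.unusedSectionVars false

noncomputable section

/-! ## The vector space `k[Q] ⊗ k^H` -/

/-- The vector space `k[Q] ⊗ k^H`, where `k^H` is the algebra `H → k` of functions on `H`. -/
abbrev GroupTensorFun (k : Type u) (Q : Type v) (H : Type w) [Field k] : Type _ :=
  MonoidAlgebra k Q ⊗[k] (H → k)

/-- The basis `x ⊗ δ_h` of `k[Q] ⊗ k^H`. -/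
def GroupTensorFun.basis (k : Type u) (Q : Type v) (H : Type w) [Field k] [Fintype H] :
    Module.Basis (Q × H) k (GroupTensorFun k Q H) :=
  (MonoidAlgebra.basis Q k).tensorProduct (Pi.basisFun k H)

theorem GroupTensorFun.basis_apply (k : Type u) (Q : Type v) (H : Type w) [Field k] [Fintype H]
    [DecidableEq H] (p : Q × H) :
    GroupTensorFun.basis k Q H p = MonoidAlgebra.single p.1 (1 : k) ⊗ₜ[k] Pi.single p.2 (1 : k) := by
  simp [GroupTensorFun.basis, Module.Basis.tensorProduct_apply', MonoidAlgebra.basis]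

/-! ## The smash coproduct `k[Γ] ⋊ k^H` -/

/-- The smash coproduct `k[Γ] ⋊ k^H`; as an algebra it is the tensor product algebra
`k[Γ] ⊗ k^H`. It does not carry the tensor product coalgebra structure. -/
def SmashCoproduct (k : Type u) (Γ : Type v) (H : Type w) [Field k] : Type _ :=
  GroupTensorFun k Γ H

namespace SmashCoproduct

variable {k : Type u} {Γ : Type v} {H : Type w} [Field k] [Group Γ] [Group H]

instance : Ring (SmashCoproduct k Γ H) := inferInstanceAs (Ring (GroupTensorFun k Γ H))

instance : Algebra k (SmashCoproduct k Γ H) := inferInstanceAs (Algebra k (GroupTensorFun k Γ H))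

/-- The element `r # f = r ⊗ f` of `k[Γ] ⋊ k^H`, for `r ∈ Γ` and `f ∈ k^H`. -/
def elt (r : Γ) (f : H → k) : SmashCoproduct k Γ H :=
  (MonoidAlgebra.single r (1 : k) ⊗ₜ[k] f : GroupTensorFun k Γ H)

variable [Fintype H] [DecidableEq H]

/-- The basis `r # δ_h` of `k[Γ] ⋊ k^H`. -/
def basis : Module.Basis (Γ × H) k (SmashCoproduct k Γ H) := GroupTensorFun.basis k Γ H

/-- The basis element `r # δ_h`. -/
def e (r : Γ) (h : H) : SmashCoproduct k Γ H := elt r (Pi.single h 1)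

theorem basis_apply (r : Γ) (h : H) : (basis (r, h) : SmashCoproduct k Γ H) = e r h :=
  GroupTensorFun.basis_apply k Γ H (r, h)

theorem e_mul_e (r s : Γ) (h g : H) :
    (e r h * e s g : SmashCoproduct k Γ H) = if h = g then e (r * s) h else 0 := by
  change (MonoidAlgebra.single r (1 : k) ⊗ₜ[k] (Pi.single h 1) : GroupTensorFun k Γ H) *
    (MonoidAlgebra.single s (1 : k) ⊗ₜ[k] (Pi.single g 1) : GroupTensorFun k Γ H) = _
  rw [Algebra.TensorProduct.tmul_mul_tmul]
  split_ifs with hg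
  · subst hg
    rw [← Pi.single_mul, MonoidAlgebra.single_mul_single, one_mul]
    rfl
  · have : (Pi.single h 1 * Pi.single g 1 : H → k) = 0 := by
      ext a
      by_cases ha : a = h
      · subst ha
        simp [hg]
      · simp [ha]
    rw [this, TensorProduct.tmul_zero]
    rfl

theorem one_eq : (1 : SmashCoproduct k Γ H) = ∑ h : H, e 1 h := by
  change (1 ⊗ₜ[k] (1 : H → k) : GroupTensorFun k Γ H) =
    ∑ h : H, (MonoidAlgebra.single (1 : Γ) (1 : k) ⊗ₜ[k] (Pi.single h 1) : GroupTensorFun k Γ H)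
  rw [← TensorProduct.tmul_sum, Finset.univ_sum_single (1 : H → k) |>.symm]
  rfl

variable [MulDistribMulAction H Γ]

/-- `Δ(r # δ_h) = ∑_l (r # δ_{l⁻¹}) ⊗ (l.r # δ_{lh})`, `ε(r # δ_h) = δ_{h,1}`. -/
instance : CoalgebraStruct k (SmashCoproduct k Γ H) where
  comul := basis.constr k fun p => ∑ l : H, e p.1 l⁻¹ ⊗ₜ[k] e (l • p.1) (l * p.2)
  counit := basis.constr k fun p => if p.2 = 1 then 1 else 0

open Coalgebra

theorem comul_e (r : Γ) (h : H) : comul (R := k) (e r h : SmashCoproduct k Γ H) =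
    ∑ l : H, e r l⁻¹ ⊗ₜ[k] e (l • r) (l * h) := by
  rw [← basis_apply]
  exact basis.constr_basis k _ (r, h)

theorem counit_e (r : Γ) (h : H) :
    counit (R := k) (e r h : SmashCoproduct k Γ H) = if h = 1 then 1 else 0 := by
  rw [← basis_apply]
  exact basis.constr_basis k _ (r, h)

instance : Coalgebra k (SmashCoproduct k Γ H) where
  coassoc := by
    refine basis.ext fun p => ?_
    obtain ⟨r, h⟩ := p
    simp only [basis_apply, LinearMap.comp_apply, LinearEquiv.coe_coe, comul_e, map_sum,
      LinearMap.rTensor_tmul, LinearMap.lTensor_tmul, TensorProduct.sum_tmul,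
      TensorProduct.tmul_sum, TensorProduct.assoc_tmul]
    rw [Finset.sum_comm]
    refine Finset.sum_congr rfl fun m _ => ?_
    refine Fintype.sum_equiv (Equiv.mulRight m⁻¹) _ _ fun l => ?_
    simp [mul_smul, mul_assoc]
  rTensor_counit_comp_comul := by
    refine basis.ext fun p => ?_
    obtain ⟨r, h⟩ := p
    simp only [basis_apply, LinearMap.comp_apply, comul_e, map_sum, LinearMap.rTensor_tmul,
      counit_e, inv_eq_one]
    rw [Finset.sum_eq_single 1] <;> simp +contextual
  lTensor_counit_comp_comul := by
    refine basis.ext fun p => ?_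
    obtain ⟨r, h⟩ := p
    simp only [basis_apply, LinearMap.comp_apply, comul_e, map_sum, LinearMap.lTensor_tmul,
      counit_e, mul_eq_one_iff_eq_inv]
    rw [Finset.sum_eq_single h⁻¹] <;> simp +contextual

instance : Bialgebra k (SmashCoproduct k Γ H) where
  counit_one := by
    rw [one_eq, map_sum]
    simp [counit_e]
  mul_compr₂_counit := by
    refine basis.ext fun p => basis.ext fun p' => ?_
    obtain ⟨r, h⟩ := p
    obtain ⟨s, g⟩ := p'
    simp only [basis_apply, LinearMap.compr₂_apply, LinearMap.mul_apply', LinearMap.compl₁₂_apply,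
      e_mul_e, counit_e]
    split_ifs <;> simp_all [counit_e]
  comul_one := by
    rw [one_eq, map_sum, Algebra.TensorProduct.one_def, one_eq]
    simp only [comul_e, smul_one, TensorProduct.sum_tmul, TensorProduct.tmul_sum]
    rw [Finset.sum_comm]
    conv_rhs => rw [Finset.sum_comm]
    refine Fintype.sum_equiv (Equiv.inv H) _ _ fun l => ?_
    exact Fintype.sum_equiv (Equiv.mulLeft l) _ _ fun h => rfl
  mul_compr₂_comul := by
    refine basis.ext fun p => basis.ext fun p' => ?_
    obtain ⟨r, h⟩ := p
    obtain ⟨s, g⟩ := p'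
    simp only [basis_apply, LinearMap.compr₂_apply, LinearMap.mul_apply', LinearMap.compl₁₂_apply,
      e_mul_e, comul_e, Finset.sum_mul, Finset.mul_sum, Algebra.TensorProduct.tmul_mul_tmul,
      inv_inj]
    have key : ∀ l : H, (∑ m : H, (if l = m then (e (r * s) l⁻¹ : SmashCoproduct k Γ H) else 0)
        ⊗ₜ[k] (if l * h = m * g then (e (l • r * m • s) (l * h) : SmashCoproduct k Γ H) else 0)) =
        if h = g then e (r * s) l⁻¹ ⊗ₜ[k] e (l • (r * s)) (l * h) else 0 := by
      intro l
      rw [Finset.sum_eq_single l]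
      · split_ifs <;> simp_all
      · intro m _ hm
        simp [Ne.symm hm]
      · simp
    rw [Finset.sum_comm] 
    rw [Finset.sum_congr rfl fun l _ => key l]
    split_ifs <;> simp [comul_e]

/-- The antipode `S(r # δ_h) = h⁻¹.r⁻¹ # δ_{h⁻¹}`. -/
def antipodeMap : SmashCoproduct k Γ H →ₗ[k] SmashCoproduct k Γ H :=
  basis.constr k fun p => e (p.2⁻¹ • p.1⁻¹) p.2⁻¹

theorem antipodeMap_e (r : Γ) (h : H) :
    antipodeMap (e r h : SmashCoproduct k Γ H) = e (h⁻¹ • r⁻¹) h⁻¹ := by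
  rw [← basis_apply r h]
  exact basis.constr_basis k _ (r, h)

instance : HopfAlgebra k (SmashCoproduct k Γ H) where
  antipode := antipodeMap
  mul_antipode_rTensor_comul := by
    refine basis.ext fun p => ?_
    obtain ⟨r, h⟩ := p
    simp only [basis_apply, LinearMap.comp_apply, comul_e, map_sum, LinearMap.rTensor_tmul,
      counit_e, antipodeMap_e, LinearMap.mul'_apply, e_mul_e, Algebra.linearMap_apply,
      Algebra.algebraMap_eq_smul_one, one_eq]
    split_ifs with h1 <;> simp [h1]
  mul_antipode_lTensor_comul := by
    refine basis.ext fun p => ?_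
    obtain ⟨r, h⟩ := p
    simp only [basis_apply, LinearMap.comp_apply, comul_e, map_sum, LinearMap.lTensor_tmul,
      counit_e, antipodeMap_e, LinearMap.mul'_apply, e_mul_e, Algebra.linearMap_apply,
      Algebra.algebraMap_eq_smul_one, one_eq]
    split_ifs with h1
    · subst h1
      simp only [mul_one, if_true, one_smul]
      refine Fintype.sum_equiv (Equiv.inv H) _ _ fun l => ?_
      simp
    · have : ∀ l : H, l⁻¹ ≠ (l * h)⁻¹ := by simpa using h1
      simp only [if_neg (this _), Finset.sum_const_zero, zero_smul]

end SmashCoproduct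

/-! ## Quotient data -/

/-- A quotient datum `(H, N, Φ)` for `H ↷ Γ` whose first entry is the whole group `H`, written
`(N, Φ)`. -/
structure QuotientDatum (k : Type u) (Γ : Type v) (H : Type w) [Field k] [Group Γ] [Group H]
    [MulDistribMulAction H Γ] where
  /-- The subgroup `N` of `Γ`. -/
  N : Subgroup Γ
  normal : N.Normal
  smul_mem : ∀ (h : H) (r : Γ), r ∈ N → h • r ∈ N
  /-- The group morphism `Φ : N → (k^H)ˣ`. -/
  Φ : N →* (H → k)ˣ
  Φ_mul : ∀ (r : N) (l h : H), (Φ r : H → k) (l * h) =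
    (Φ ⟨l⁻¹ • (r : Γ), smul_mem l⁻¹ r r.2⟩ : H → k) h * (Φ r : H → k) l
  Φ_conj : ∀ (r : N) (s : Γ), Φ r = Φ ⟨s * r * s⁻¹, normal.conj_mem r r.2 s⟩

/-- A section `j : Γ/N → Γ` of the canonical projection, with `j(1) = 1`. -/
structure NormalizedSection {Γ : Type v} [Group Γ] (N : Subgroup Γ) where
  /-- The underlying map. -/
  toFun : Γ ⧸ N → Γ
  mk_toFun : ∀ x : Γ ⧸ N, (QuotientGroup.mk (toFun x) : Γ ⧸ N) = x
  map_one : toFun (QuotientGroup.mk 1) = 1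

namespace QuotientDatum

variable {k : Type u} {Γ : Type v} {H : Type w} [Field k] [Group Γ] [Group H]
  [MulDistribMulAction H Γ] (D : QuotientDatum k Γ H)

instance : D.N.Normal := D.normal

/-- The action of `h ∈ H` on `Γ/N` induced by the action on `Γ`. -/
def act (h : H) : Γ ⧸ D.N →* Γ ⧸ D.N :=
  QuotientGroup.map D.N D.N (MulDistribMulAction.toMonoidHom Γ h) fun r hr => D.smul_mem h r hr

theorem act_mk (h : H) (r : Γ) :
    D.act h (QuotientGroup.mk r) = QuotientGroup.mk (h • r) := rfl

theorem act_mul (h g : H) (x : Γ ⧸ D.N) : D.act (h * g) x = D.act h (D.act g x) := by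
  induction x using QuotientGroup.induction_on with
  | H r => simp [act_mk, mul_smul]

theorem act_one (x : Γ ⧸ D.N) : D.act 1 x = x := by
  induction x using QuotientGroup.induction_on with
  | H r => simp [act_mk]

theorem act_inv_act (h : H) (x : Γ ⧸ D.N) : D.act h⁻¹ (D.act h x) = x := by
  rw [← act_mul, inv_mul_cancel, act_one]

open Classical in
/-- Auxiliary extension of `Φ` by zero, used only in proofs. -/
def P (r : Γ) (h : H) : k := if hr : r ∈ D.N then (D.Φ ⟨r, hr⟩ : H → k) h else 0

theorem P_eq (r : Γ) (hr : r ∈ D.N) (h : H) : (D.Φ ⟨r, hr⟩ : H → k) h = D.P r h := by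
  simp [P, hr]

theorem P_one (h : H) : D.P 1 h = 1 := by
  rw [← D.P_eq 1 D.N.one_mem]
  have : (⟨1, D.N.one_mem⟩ : D.N) = 1 := rfl
  rw [this, map_one]
  rfl

theorem P_mul {r s : Γ} (hr : r ∈ D.N) (hs : s ∈ D.N) (h : H) :
    D.P r h * D.P s h = D.P (r * s) h := by
  rw [← D.P_eq r hr, ← D.P_eq s hs, ← D.P_eq _ (D.N.mul_mem hr hs)]
  have : (⟨r * s, D.N.mul_mem hr hs⟩ : D.N) = ⟨r, hr⟩ * ⟨s, hs⟩ := rfl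
  rw [this, map_mul]
  rfl

theorem P_conj {r : Γ} (hr : r ∈ D.N) (s : Γ) (h : H) : D.P (s * r * s⁻¹) h = D.P r h := by
  rw [← D.P_eq r hr, ← D.P_eq _ (D.normal.conj_mem r hr s), ← D.Φ_conj ⟨r, hr⟩ s]

theorem P_comm {r s : Γ} (hr : r * s ∈ D.N) (h : H) : D.P (s * r) h = D.P (r * s) h := by
  rw [← D.P_conj hr s]
  congr 1
  group

theorem P_coc {r : Γ} (hr : r ∈ D.N) (l h : H) :
    D.P r (l * h) = D.P (l⁻¹ • r) h * D.P r l := by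
  rw [← D.P_eq r hr, ← D.P_eq r hr, ← D.P_eq _ (D.smul_mem l⁻¹ r hr)]
  exact D.Φ_mul ⟨r, hr⟩ l h

theorem P_apply_one {r : Γ} (hr : r ∈ D.N) : D.P r (1 : H) = 1 := by
  have h1 := D.P_coc hr 1 1
  have h2 : D.P r (1 : H) * D.P r⁻¹ (1 : H) = 1 := by
    rw [D.P_mul hr (D.N.inv_mem hr), mul_inv_cancel, P_one]
  simp only [mul_one, inv_one, one_smul] at h1
  exact (mul_eq_left₀ (left_ne_zero_of_mul_eq_one h2)).1 h1.symm

/-- `Φ(h.r)(h) = Φ(r⁻¹)(h⁻¹)`. -/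
theorem P_smul {r : Γ} (hr : r ∈ D.N) (h : H) : D.P (h • r) h = D.P r⁻¹ h⁻¹ := by
  have h1 := D.P_coc hr h⁻¹ h
  rw [inv_mul_cancel, D.P_apply_one hr, inv_inv] at h1
  have h2 : D.P r h⁻¹ * D.P r⁻¹ h⁻¹ = 1 := by
    rw [D.P_mul hr (D.N.inv_mem hr), mul_inv_cancel, P_one]
  calc D.P (h • r) h = D.P (h • r) h * (D.P r h⁻¹ * D.P r⁻¹ h⁻¹) := by rw [h2, mul_one]
    _ = D.P r⁻¹ h⁻¹ := by rw [← mul_assoc, ← h1, one_mul]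

theorem P_triple {a b c : Γ} (h1 : a * b⁻¹ ∈ D.N) (h2 : c⁻¹ * a⁻¹ ∈ D.N) (h3 : c * b ∈ D.N)
    (h : H) : D.P (a * b⁻¹) h * D.P (c⁻¹ * a⁻¹) h * D.P (c * b) h = 1 := by
  have h4 : b⁻¹ * a ∈ D.N := D.normal.mem_comm h1
  have h5 : a⁻¹ * c⁻¹ ∈ D.N := D.normal.mem_comm h2
  rw [← D.P_comm h1, ← D.P_comm h2, mul_comm, D.P_mul h4 h5,
    D.P_mul h3 (D.N.mul_mem h4 h5), ← D.P_one h]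
  congr 1
  group

variable (j : NormalizedSection D.N)

theorem mem_of_mk_eq_one {r : Γ} (h : (QuotientGroup.mk r : Γ ⧸ D.N) = 1) : r ∈ D.N :=
  (QuotientGroup.eq_one_iff r).1 h

theorem mem_mul (x y : Γ ⧸ D.N) :
    j.toFun x * j.toFun y * (j.toFun (x * y))⁻¹ ∈ D.N := by
  apply D.mem_of_mk_eq_one
  simp [j.mk_toFun]

theorem mem_act (l : H) (x : Γ ⧸ D.N) :
    (l • j.toFun x) * (j.toFun (D.act l x))⁻¹ ∈ D.N := by
  apply D.mem_of_mk_eq_one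
  rw [QuotientGroup.mk_mul, QuotientGroup.mk_inv, ← act_mk, j.mk_toFun, j.mk_toFun, mul_inv_cancel]

theorem mem_antipode (h : H) (x : Γ ⧸ D.N) :
    (j.toFun (D.act h⁻¹ x⁻¹))⁻¹ * (h⁻¹ • (j.toFun x)⁻¹) ∈ D.N := by
  apply D.mem_of_mk_eq_one
  rw [QuotientGroup.mk_mul, QuotientGroup.mk_inv, ← act_mk, QuotientGroup.mk_inv, j.mk_toFun,
    j.mk_toFun, inv_mul_cancel]

theorem mem_mk (r : Γ) : r * (j.toFun (QuotientGroup.mk r))⁻¹ ∈ D.N := by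
  apply D.mem_of_mk_eq_one
  rw [QuotientGroup.mk_mul, QuotientGroup.mk_inv, j.mk_toFun, mul_inv_cancel]

/-! ## The Hopf algebra `k[Γ/N] ⋊_Φ k^H` -/

/-- The Hopf algebra `k[Γ/N] ⋊_Φ k^H` attached to a quotient datum, formed with the section `j`;
its underlying vector space is `k[Γ/N] ⊗ k^H`. -/
def Twisted (_j : NormalizedSection D.N) : Type _ := GroupTensorFun k (Γ ⧸ D.N) H

namespace Twisted

variable {D} {j}

instance : AddCommGroup (D.Twisted j) := inferInstanceAs (AddCommGroup (GroupTensorFun k _ H))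

instance : Module k (D.Twisted j) := inferInstanceAs (Module k (GroupTensorFun k _ H))

/-- The element `x # f = x ⊗ f` of `k[Γ/N] ⋊_Φ k^H`, for `x ∈ Γ/N` and `f ∈ k^H`. -/
def elt (x : Γ ⧸ D.N) (f : H → k) : D.Twisted j :=
  (MonoidAlgebra.single x (1 : k) ⊗ₜ[k] f : GroupTensorFun k _ H)

instance : One (D.Twisted j) := ⟨elt 1 1⟩

variable [Fintype H] [DecidableEq H]

/-- The basis `x # δ_h` of `k[Γ/N] ⋊_Φ k^H`. -/
def basis : Module.Basis ((Γ ⧸ D.N) × H) k (D.Twisted j) := GroupTensorFun.basis k _ H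

/-- The basis element `x # δ_h`. -/
def e (x : Γ ⧸ D.N) (h : H) : D.Twisted j := elt x (Pi.single h 1)

theorem basis_apply (x : Γ ⧸ D.N) (h : H) : (basis (x, h) : D.Twisted j) = e x h :=
  GroupTensorFun.basis_apply k _ H (x, h)

theorem one_eq : (1 : D.Twisted j) = ∑ h : H, e 1 h := by
  change (MonoidAlgebra.single 1 1 ⊗ₜ[k] (1 : H → k) : GroupTensorFun k (Γ ⧸ D.N) H) =
    ∑ h : H, (MonoidAlgebra.single 1 (1 : k) ⊗ₜ[k] (Pi.single h 1) : GroupTensorFun k _ H)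
  rw [← TensorProduct.tmul_sum, Finset.univ_sum_single (1 : H → k) |>.symm]
  rfl

/-- The product
`(x # δ_h)(y # δ_g) = xy # δ_h δ_g Φ(j(x) j(y) j(xy)⁻¹)`, as a bilinear map. -/
def mulMap : D.Twisted j →ₗ[k] D.Twisted j →ₗ[k] D.Twisted j :=
  basis.constr k fun p => basis.constr k fun q =>
    elt (p.1 * q.1) (Pi.single p.2 1 * Pi.single q.2 1 *
      (D.Φ ⟨j.toFun p.1 * j.toFun q.1 * (j.toFun (p.1 * q.1))⁻¹, D.mem_mul j p.1 q.1⟩ : H → k))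

instance : Mul (D.Twisted j) := ⟨fun a b => mulMap a b⟩

theorem elt_smul (x : Γ ⧸ D.N) (c : k) (f : H → k) : (elt x (c • f) : D.Twisted j) = c • elt x f :=
  TensorProduct.tmul_smul c (MonoidAlgebra.single x (1 : k)) f

theorem elt_single_mul (x : Γ ⧸ D.N) (h : H) (f : H → k) :
    (elt x (Pi.single h 1 * f) : D.Twisted j) = f h • e x h := by
  rw [e, ← elt_smul]
  congr 1
  ext a
  by_cases ha : a = h
  · subst ha
    simp
  · simp [ha]

theorem mulMap_e_e (x y : Γ ⧸ D.N) (h g : H) : mulMap (e x h : D.Twisted j) (e y g) =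
    if h = g then D.P (j.toFun x * j.toFun y * (j.toFun (x * y))⁻¹) h • e (x * y) h else 0 := by
  have h1 : mulMap (e x h : D.Twisted j) (e y g) = elt (x * y) (Pi.single h 1 * Pi.single g 1 *
      (D.Φ ⟨j.toFun x * j.toFun y * (j.toFun (x * y))⁻¹, D.mem_mul j x y⟩ : H → k)) := by
    rw [← basis_apply x h, ← basis_apply y g, mulMap, Module.Basis.constr_basis,
      Module.Basis.constr_basis]
  rw [h1, mul_assoc, elt_single_mul, Pi.mul_apply, P_eq]
  split_ifs with hg
  · subst hg
    simp
  · simp [hg]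

theorem mul_def (a b : D.Twisted j) : a * b = mulMap a b := rfl

theorem e_mul_e (x y : Γ ⧸ D.N) (h g : H) : (e x h : D.Twisted j) * e y g =
    if h = g then D.P (j.toFun x * j.toFun y * (j.toFun (x * y))⁻¹) h • e (x * y) h else 0 :=
  mulMap_e_e x y h g

theorem toFun_one : j.toFun 1 = 1 := j.map_one

theorem one_mul' (a : D.Twisted j) : mulMap 1 a = a := by
  suffices h : mulMap (1 : D.Twisted j) = LinearMap.id from LinearMap.congr_fun h a
  refine basis.ext fun p => ?_
  obtain ⟨x, h⟩ := p
  rw [basis_apply, one_eq, map_sum, LinearMap.sum_apply]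
  simp [mulMap_e_e, toFun_one, P_one]

theorem mul_one' (a : D.Twisted j) : mulMap a 1 = a := by
  suffices h : mulMap.flip (1 : D.Twisted j) = LinearMap.id from LinearMap.congr_fun h a
  refine basis.ext fun p => ?_
  obtain ⟨x, h⟩ := p
  rw [basis_apply, one_eq, map_sum, LinearMap.sum_apply]
  simp [mulMap_e_e, toFun_one, P_one]

theorem mul_assoc' (a b c : D.Twisted j) : mulMap (mulMap a b) c = mulMap a (mulMap b c) := by
  suffices h : LinearMap.compr₂ mulMap mulMap =
      LinearMap.compl₂ (LinearMap.llcomp k (D.Twisted j) _ _ ∘ₗ mulMap) mulMap from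
    LinearMap.congr_fun (LinearMap.congr_fun (LinearMap.congr_fun h a) b) c
  refine basis.ext fun p => basis.ext fun p' => basis.ext fun p'' => ?_
  obtain ⟨x, h⟩ := p
  obtain ⟨y, g⟩ := p'
  obtain ⟨z, f⟩ := p''
  simp only [basis_apply, LinearMap.compr₂_apply, LinearMap.compl₂_apply, LinearMap.comp_apply,
    LinearMap.llcomp_apply, mulMap_e_e]
  by_cases hg : h = g
  · subst hg
    by_cases hf : h = f
    · subst hf
      simp only [if_true, map_smul, LinearMap.smul_apply, mulMap_e_e, smul_smul, mul_assoc x y z]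
      congr 1
      have h1 := D.mem_mul j x y
      have h2 := D.mem_mul j (x * y) z
      have h3 := D.mem_mul j y z
      have h4 := D.mem_mul j x (y * z)
      rw [mul_assoc x y z] at h2
      rw [← D.P_conj h3 (j.toFun x), D.P_mul h1 h2, D.P_mul (D.normal.conj_mem _ h3 _) h4]
      congr 1
      group
    · simp [hf, mulMap_e_e]
  · simp only [if_neg hg, map_zero, LinearMap.zero_apply]
    by_cases hf : g = f
    · simp [hf, mulMap_e_e]
      intro h'
      exact absurd (h'.trans hf.symm) hg
    · simp [hf]

instance : Ring (D.Twisted j) where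
  __ := (inferInstance : AddCommGroup (D.Twisted j))
  left_distrib a b c := map_add (mulMap a) b c
  right_distrib a b c := LinearMap.map_add₂ mulMap a b c
  zero_mul a := LinearMap.map_zero₂ mulMap a
  mul_zero a := map_zero (mulMap a)
  one_mul := one_mul'
  mul_one := mul_one'
  mul_assoc := mul_assoc'

instance : Algebra k (D.Twisted j) :=
  Algebra.ofModule (fun c a b => LinearMap.map_smul₂ mulMap c a b)
    fun c a b => map_smul (mulMap a) c b

variable (D j) in
/-- The coefficient `Φ(l.j(x) j(l.x)⁻¹)` of the comultiplication. -/
def comulCoeff (l : H) (x : Γ ⧸ D.N) : H → k :=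
  D.Φ ⟨(l • j.toFun x) * (j.toFun (D.act l x))⁻¹, D.mem_act j l x⟩

variable (D j) in
/-- The coefficient `Φ(j(h⁻¹.x⁻¹)⁻¹ h⁻¹.j(x)⁻¹)` of the antipode. -/
def antipodeCoeff (h : H) (x : Γ ⧸ D.N) : H → k :=
  D.Φ ⟨(j.toFun (D.act h⁻¹ x⁻¹))⁻¹ * (h⁻¹ • (j.toFun x)⁻¹), D.mem_antipode j h x⟩

/-- `Δ(x # δ_h) = ∑_l (x # δ_{l⁻¹}) ⊗ (l.x # δ_{lh} Φ(l.j(x) j(l.x)⁻¹))` and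
`ε(x # δ_h) = δ_{h,1}`. -/
instance : CoalgebraStruct k (D.Twisted j) where
  comul := basis.constr k fun p => ∑ l : H,
    e p.1 l⁻¹ ⊗ₜ[k] elt (D.act l p.1) (Pi.single (l * p.2) 1 * comulCoeff D j l p.1)
  counit := basis.constr k fun p => if p.2 = 1 then 1 else 0

open Coalgebra

theorem comul_e (x : Γ ⧸ D.N) (h : H) : comul (R := k) (e x h : D.Twisted j) =
    ∑ l : H, D.P ((l • j.toFun x) * (j.toFun (D.act l x))⁻¹) (l * h) •
      (e x l⁻¹ ⊗ₜ[k] e (D.act l x) (l * h)) := by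
  rw [← basis_apply]
  refine (basis.constr_basis k _ (x, h)).trans ?_
  refine Finset.sum_congr rfl fun l _ => ?_
  rw [elt_single_mul, TensorProduct.tmul_smul, comulCoeff, P_eq]

theorem counit_e (x : Γ ⧸ D.N) (h : H) :
    counit (R := k) (e x h : D.Twisted j) = if h = 1 then 1 else 0 := by
  rw [← basis_apply]
  exact basis.constr_basis k _ (x, h)

instance : Coalgebra k (D.Twisted j) where
  coassoc := by
    refine basis.ext fun p => ?_
    obtain ⟨x, h⟩ := p
    simp only [basis_apply, LinearMap.comp_apply, LinearEquiv.coe_coe, comul_e, map_sum, map_smul,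
      LinearMap.rTensor_tmul, LinearMap.lTensor_tmul, TensorProduct.sum_tmul,
      TensorProduct.tmul_sum, TensorProduct.assoc_tmul, Finset.smul_sum, TensorProduct.tmul_smul,
      ← TensorProduct.smul_tmul', smul_smul]
    rw [Finset.sum_comm]
    refine Finset.sum_congr rfl fun m _ => ?_
    refine Fintype.sum_equiv (Equiv.mulRight m⁻¹) _ _ fun l => ?_
    have e1 : D.act (l * m⁻¹) (D.act m x) = D.act l x := by
      rw [← D.act_mul, inv_mul_cancel_right]
    simp only [Equiv.coe_mulRight, e1, mul_inv_rev, inv_inv]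
    congr 1
    · have h1 := D.mem_act j l x
      have h2 := D.mem_act j m x
      have h3 := D.mem_act j (l * m⁻¹) (D.act m x)
      rw [e1] at h3
      have h4 := D.smul_mem (l * m⁻¹) _ h2
      have c := D.P_coc h2 (m * l⁻¹) (l * h)
      have e2 : m * l⁻¹ * (l * h) = m * h := by group
      have e3 : l * m⁻¹ * (m * h) = l * h := by group
      rw [e2, mul_inv_rev, inv_inv] at c
      rw [c, e3, mul_right_comm, D.P_mul h4 h3]
      congr 2
      simp [smul_mul', smul_inv', mul_smul]
    · have e3 : l * m⁻¹ * (m * h) = l * h := by group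
      rw [e3]
  rTensor_counit_comp_comul := by
    refine basis.ext fun p => ?_
    obtain ⟨x, h⟩ := p
    simp only [basis_apply, LinearMap.comp_apply, comul_e, map_sum, map_smul,
      LinearMap.rTensor_tmul, counit_e, inv_eq_one]
    rw [Finset.sum_eq_single 1] <;> simp +contextual [act_one, P_one]
  lTensor_counit_comp_comul := by
    refine basis.ext fun p => ?_
    obtain ⟨x, h⟩ := p
    simp only [basis_apply, LinearMap.comp_apply, comul_e, map_sum, map_smul,
      LinearMap.lTensor_tmul, counit_e, mul_eq_one_iff_eq_inv]
    rw [Finset.sum_eq_single h⁻¹] <;>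
      simp +contextual [D.P_apply_one (D.mem_act j h⁻¹ x)]

instance : Bialgebra k (D.Twisted j) where
  counit_one := by
    rw [one_eq, map_sum]
    simp [counit_e]
  mul_compr₂_counit := by
    refine basis.ext fun p => basis.ext fun p' => ?_
    obtain ⟨x, h⟩ := p
    obtain ⟨y, g⟩ := p'
    simp only [basis_apply, LinearMap.compr₂_apply, LinearMap.mul_apply', LinearMap.compl₁₂_apply,
      e_mul_e, counit_e]
    have := D.P_apply_one (D.mem_mul j x y)
    split_ifs <;> simp_all [counit_e]
  comul_one := by
    rw [one_eq, map_sum, Algebra.TensorProduct.one_def, one_eq]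
    simp only [comul_e, map_one, toFun_one, smul_one, inv_one, mul_one, P_one, one_smul,
      TensorProduct.sum_tmul, TensorProduct.tmul_sum]
    rw [Finset.sum_comm]
    conv_rhs => rw [Finset.sum_comm]
    refine Fintype.sum_equiv (Equiv.inv H) _ _ fun l => ?_
    exact Fintype.sum_equiv (Equiv.mulLeft l) _ _ fun h => rfl
  mul_compr₂_comul := by
    refine basis.ext fun p => basis.ext fun p' => ?_
    obtain ⟨x, h⟩ := p
    obtain ⟨y, g⟩ := p'
    simp only [basis_apply, LinearMap.compr₂_apply, LinearMap.mul_apply', LinearMap.compl₁₂_apply,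
      e_mul_e, comul_e, Finset.sum_mul, Finset.mul_sum, Algebra.TensorProduct.tmul_mul_tmul,
      inv_inj, smul_mul_smul_comm]
    rw [Finset.sum_comm]
    by_cases hg : h = g
    · subst hg
      simp only [if_true, map_smul, comul_e, Finset.smul_sum]
      refine Finset.sum_congr rfl fun l _ => ?_
      rw [Finset.sum_eq_single l]
      · simp only [if_true, ← TensorProduct.smul_tmul', TensorProduct.tmul_smul, smul_smul, map_mul]
        congr 1
        have m1 := D.mem_mul j x y
        have m2 := D.mem_act j l (x * y)
        have m3 := D.mem_act j l x
        have m4 := D.mem_act j l y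
        have m5 := D.mem_mul j (D.act l x) (D.act l y)
        have m6 := D.smul_mem l _ m1
        have c := D.P_coc m1 l⁻¹ (l * h)
        rw [inv_mul_cancel_left, inv_inv] at c
        rw [map_mul] at m2
        have q : D.P (l • (j.toFun x * j.toFun y * (j.toFun (x * y))⁻¹)) (l * h) *
            D.P (l • j.toFun (x * y) * (j.toFun (D.act l x * D.act l y))⁻¹) (l * h) =
            D.P (l • j.toFun x * (j.toFun (D.act l x))⁻¹) (l * h) *
            D.P (l • j.toFun y * (j.toFun (D.act l y))⁻¹) (l * h) *
            D.P (j.toFun (D.act l x) * j.toFun (D.act l y) *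
              (j.toFun (D.act l x * D.act l y))⁻¹) (l * h) := by
          have m4' := D.normal.conj_mem _ m4 (j.toFun (D.act l x))
          rw [← D.P_conj m4 (j.toFun (D.act l x)), D.P_mul m6 m2, D.P_mul m3 m4',
            D.P_mul (D.N.mul_mem m3 m4') m5]
          congr 1
          simp only [smul_mul', smul_inv']
          group
        rw [c, mul_right_comm, q]
        ring
      · intro m _ hm
        simp [Ne.symm hm]
      · simp
    · simp only [if_neg hg, map_zero]
      symm
      refine Finset.sum_eq_zero fun l _ => Finset.sum_eq_zero fun m _ => ?_
      by_cases hm : l = m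
      · subst hm
        simp [hg]
      · simp [hm]

/-- The antipode `S(x # δ_h) = h⁻¹.x⁻¹ # Φ(j(h⁻¹.x⁻¹)⁻¹ h⁻¹.j(x)⁻¹) δ_{h⁻¹}`. -/
def antipodeMap : D.Twisted j →ₗ[k] D.Twisted j :=
  basis.constr k fun p =>
    elt (D.act p.2⁻¹ p.1⁻¹) (antipodeCoeff D j p.2 p.1 * Pi.single p.2⁻¹ 1)

theorem antipodeMap_e (x : Γ ⧸ D.N) (h : H) : antipodeMap (e x h : D.Twisted j) =
    D.P ((j.toFun (D.act h⁻¹ x⁻¹))⁻¹ * (h⁻¹ • (j.toFun x)⁻¹)) h⁻¹ • e (D.act h⁻¹ x⁻¹) h⁻¹ := by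
  rw [← basis_apply x h]
  refine (basis.constr_basis k _ (x, h)).trans ?_
  rw [mul_comm, elt_single_mul, antipodeCoeff, P_eq]

instance : HopfAlgebra k (D.Twisted j) where
  antipode := antipodeMap
  mul_antipode_rTensor_comul := by
    refine basis.ext fun p => ?_
    obtain ⟨x, h⟩ := p
    simp only [basis_apply, LinearMap.comp_apply, comul_e, map_sum, map_smul,
      LinearMap.rTensor_tmul, counit_e, antipodeMap_e, LinearMap.mul'_apply, e_mul_e,
      smul_mul_assoc, Algebra.linearMap_apply, Algebra.algebraMap_eq_smul_one, one_eq, inv_inv]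
    by_cases h1 : h = 1
    · subst h1
      simp only [mul_one, if_true, one_smul]
      refine Finset.sum_congr rfl fun l _ => ?_
      have m1 := D.mem_act j l x
      have m2 := D.mem_antipode j l⁻¹ x
      have m3 := D.mem_mul j (D.act l x⁻¹) (D.act l x)
      have e1 : D.act l x⁻¹ * D.act l x = 1 := by rw [← map_mul, inv_mul_cancel, map_one]
      rw [inv_inv] at m2
      rw [e1] at m3
      rw [toFun_one, inv_one, mul_one] at m3
      rw [smul_inv'] at m2
      rw [e1, smul_smul, smul_smul, toFun_one, inv_one, mul_one, smul_inv', D.P_triple m1 m2 m3,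
        one_smul]
    · have : ∀ l : H, l ≠ l * h := by simpa using h1
      simp only [if_neg (this _), if_neg h1, smul_zero, Finset.sum_const_zero, zero_smul]
  mul_antipode_lTensor_comul := by
    refine basis.ext fun p => ?_
    obtain ⟨x, h⟩ := p
    simp only [basis_apply, LinearMap.comp_apply, comul_e, map_sum, map_smul,
      LinearMap.lTensor_tmul, counit_e, antipodeMap_e, LinearMap.mul'_apply, e_mul_e,
      mul_smul_comm, Algebra.linearMap_apply, Algebra.algebraMap_eq_smul_one, one_eq]
    by_cases h1 : h = 1
    · subst h1
      simp only [mul_one, if_true, one_smul]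
      refine Fintype.sum_equiv (Equiv.inv H) _ _ fun l => ?_
      have m1 := D.mem_act j l x
      have m2 := D.mem_antipode j l (D.act l x)
      have m3 := D.mem_mul j x x⁻¹
      have e1 : D.act l⁻¹ (D.act l x)⁻¹ = x⁻¹ := by rw [map_inv, act_inv_act]
      have m4 := D.smul_mem l⁻¹ _ m1
      have e2 : l • j.toFun x * (j.toFun (D.act l x))⁻¹ =
          l • (j.toFun x * (l⁻¹ • j.toFun (D.act l x))⁻¹) := by
        simp [smul_mul', smul_inv']
      rw [e2, inv_smul_smul] at m4
      rw [e1, smul_inv'] at m2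
      rw [mul_inv_cancel, toFun_one, inv_one, mul_one] at m3
      have m5 := D.N.inv_mem m4
      rw [mul_inv_rev, inv_inv] at m5
      rw [e1, e2, D.P_smul m4, smul_smul, smul_smul, mul_inv_cancel, toFun_one,
        inv_one, mul_one, smul_inv', mul_inv_rev, inv_inv, ← D.P_comm m3,
        D.P_triple m5 m2 (D.normal.mem_comm m3), one_smul, Equiv.inv_apply]
    · have : ∀ l : H, l⁻¹ ≠ (l * h)⁻¹ := by simpa using h1
      simp only [if_neg (this _), if_neg h1, smul_zero, Finset.sum_const_zero, zero_smul]

end Twisted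

end QuotientDatum

/-! ## Hopf images -/

section HopfImage

universe a b c d

variable {k : Type u} [Field k] {A : Type a} [Ring A] [HopfAlgebra k A] {R : Type b} [Ring R]
  [Algebra k R]

/-- `(L, q, φ)` is a factorization of the algebra map `ρ : A → R` through the Hopf algebra `L`:
`q : A → L` is a surjective Hopf algebra map, `φ : L → R` is an algebra map, and `ρ = φ ∘ q`. -/
structure IsHopfFactorization {L : Type c} [Ring L] [HopfAlgebra k L] (ρ : A →ₐ[k] R)
    (q : A →ₐc[k] L) (φ : L →ₐ[k] R) : Prop where
  surjective : Function.Surjective q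
  factors : ∀ a : A, φ (q a) = ρ a

/-- `(L, p, φ)` is the Hopf image of `ρ`: the final object among the factorizations `(M, q, ψ)`
of `ρ` (with `M` in an arbitrary universe `d`). -/
structure IsHopfImage {L : Type c} [Ring L] [HopfAlgebra k L] (ρ : A →ₐ[k] R)
    (p : A →ₐc[k] L) (φ : L →ₐ[k] R) : Prop where
  isHopfFactorization : IsHopfFactorization ρ p φ
  existsUnique : ∀ (M : Type d) [Ring M] [HopfAlgebra k M] (q : A →ₐc[k] M) (ψ : M →ₐ[k] R),
    IsHopfFactorization ρ q ψ →
      ∃! f : M →ₐc[k] L, (∀ a : A, f (q a) = p a) ∧ ∀ m : M, φ (f m) = ψ m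

end HopfImage

/-- The set `E(ρ)` of quotient data `(N, Φ)` with `ρ(r # 1) = ρ(1 # Φ(r))` for all `r ∈ N`. -/
def compatibleData {k : Type u} {Γ : Type v} {H : Type w} {R : Type x} [Field k] [Group Γ]
    [Group H] [MulDistribMulAction H Γ] [Ring R] [Algebra k R]
    (ρ : SmashCoproduct k Γ H →ₐ[k] R) : Set (QuotientDatum k Γ H) :=
  {D | ∀ r : D.N, ρ (.elt (r : Γ) 1) = ρ (.elt 1 (D.Φ r : H → k))}

end

/-! The datum `maximalDatum` collects the `r` whose whole `H`-orbit acts through `k^H` under `ρ`,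
with coefficients satisfying the cocycle identity. It is compatible with `ρ`, so `ρ` factors through
its quotient by rewriting `r` as an element of `N` times a representative. What needs an argument is
finality: a factorization `(M, q, ψ)` must not impose relations that are absent from this quotient.

The tool is to cut the comultiplication of `M` into components. Multiplying by `q(1 # δ_m) ⊗ q(1 #
δ_n)` gives a linear map `T_{m,n}` (`comulComponent`) that sends `q(r # δ_{mn})` to the pure tensor
`q(r # δ_m) ⊗ q(m⁻¹.r # δ_n)` and kills the other `q(r # δ_h)`. All these vectors are nonzero,
because `ρ` is injective on `k^H`.

For `m = n = 1` the vectors `a = q(r # δ_1)` satisfy `T a = a ⊗ a`, so distinct ones are linearly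
independent (`linearIndepOn_of_map_eq_tmul_self`). Everything is thus governed by the `r` with `q(r
# δ_1) = q(1 # δ_1)`. For such `r`, comparing pure tensors shows that the whole orbit has the same
property, that `q(r # δ_h) = f(h) q(1 # δ_h)`, and that the functions `f` along the orbit satisfy
the cocycle identity (`map_e_one_smul_eq`, `exists_map_e_eq_smul`, `mul_eq_of_map_e_eq_smul`).
Applying `ψ` identifies `f` with `Φ(r)`, so `r ∈ N`. Hence the quotient map factors linearly through
`q` (`exists_bialgHom_comp_eq_quotientMap`), and surjectivity of `q` makes the factor a bialgebra
map and makes it unique. -/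

/-! ## Linear algebra -/

section LinearAlgebra

variable {K : Type*} [Field K] {V : Type*} [AddCommGroup V] [Module K V]
  {W : Type*} [AddCommGroup W] [Module K W]

open Submodule in
/-- Nonzero vectors `a` with `T a = a ⊗ a`, for a fixed linear map `T`, are linearly independent. -/
theorem linearIndepOn_of_map_eq_tmul_self (T : V →ₗ[K] V ⊗[K] V) {t : Set V}
    (hT : ∀ a ∈ t, T a = a ⊗ₜ[K] a) (h0 : ∀ a ∈ t, a ≠ 0) : LinearIndepOn K id t := by
  classical
  rw [linearIndepOn_iff_linearIndepOn_finset]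
  rintro s hs
  replace hs : ∀ a ∈ s, a ∈ t := fun a ha => hs ha
  induction s using Finset.cons_induction with
  | empty => simp
  | cons a s has ih =>
  simp only [Finset.cons_eq_insert, Finset.mem_insert, forall_eq_or_imp] at hs
  obtain ⟨ha, hs⟩ := hs
  specialize ih hs
  rw [Finset.coe_cons]
  refine ih.id_insert' ?_
  simp only [mem_span_finset, forall_exists_index, and_imp]
  rintro d c - hc
  -- The tensors `x ⊗ y` with `x, y ∈ s` are independent too, so coefficients can be compared in `V
  -- ⊗ V`.
  replace ih := ih.tmul_of_isDomain ih
  simp_rw [← Finset.coe_product, linearIndepOn_finset_iffₛ, id] at ih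
  -- From `d a = ∑ c_x x`, two evaluations of `d T(d a)` give `c_x c_y = 0` for `x ≠ y` and `c_x² =
  -- d c_x`. A nonzero `c_x` would then be the only one and equal to `d`, forcing `a = x ∈ s`.
  have key := calc
        ∑ x ∈ s, ∑ y ∈ s, (if x = y then d * c x else 0) • x ⊗ₜ[K] y
    _ = d • ∑ x ∈ s, c x • x ⊗ₜ[K] x := by simp [Finset.smul_sum, mul_smul]
    _ = d • T (d • a) := by
      rw [← hc, map_sum]
      congr 1
      exact Finset.sum_congr rfl fun x hx => by rw [map_smul, hT x (hs x hx)]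
    _ = (d • a) ⊗ₜ (d • a) := by
      rw [map_smul, hT a ha, TensorProduct.tmul_smul, TensorProduct.smul_tmul']
    _ = ∑ x ∈ s, ∑ y ∈ s, (c x * c y) • x ⊗ₜ[K] y := by
      simp_rw [← hc, TensorProduct.sum_tmul, TensorProduct.smul_tmul, Finset.smul_sum,
        TensorProduct.tmul_sum, TensorProduct.tmul_smul, mul_smul]
  simp_rw [← Finset.sum_product'] at key
  apply ih at key
  replace key x (hx : x ∈ s) : c x = 0 := by
    by_contra! hcx
    have hcy (y) (hys : y ∈ s) (hyx : y ≠ x) : c y = 0 := by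
      simpa [*] using (key (y, x) (by simp [*])).symm
    rw [Finset.sum_eq_single x (by simp +contextual [hcy]) (by simp [hx])] at hc
    have hcxa : d = c x := mul_left_injective₀ hcx (by simpa using (key (x, x) (by simp [*])))
    obtain rfl : x = a := by rwa [hcxa, smul_right_inj hcx] at hc
    contradiction
  rw [Finset.sum_eq_zero fun x hx => by rw [key x hx, zero_smul]] at hc
  exact (smul_eq_zero.1 hc.symm).resolve_right (h0 a ha)

theorem LinearIndepOn.exists_linearMap {t : Set V} (ht : LinearIndepOn K id t) (g : V → W) :
    ∃ G : V →ₗ[K] W, ∀ a ∈ t, G a = g a := by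
  refine ⟨(Module.Basis.extend ht).constr K fun a => g a, fun a ha => ?_⟩
  have := (Module.Basis.extend ht).constr_basis K (fun a => g (a : V))
    ⟨a, ht.subset_extend (Set.subset_univ _) ha⟩
  simpa using this

/-- Contract the second leg with a functional taking the value 1 on `b`; the scalar is its value on
`b'`. -/
theorem exists_eq_smul_of_tmul_eq_tmul {a a' : V} {b b' : W} (hb : b ≠ 0)
    (h : a ⊗ₜ[K] b = a' ⊗ₜ[K] b') : ∃ c : K, a = c • a' := by
  obtain ⟨φ, hφ⟩ := Module.Projective.exists_dual_eq_one K hb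
  refine ⟨φ b', ?_⟩
  have := congrArg (TensorProduct.rid K V ∘ LinearMap.lTensor V φ) h
  simpa [hφ] using this

theorem exists_eq_smul_of_tmul_eq_tmul' {a a' : V} {b b' : W} (ha : a ≠ 0)
    (h : a ⊗ₜ[K] b = a' ⊗ₜ[K] b') : ∃ c : K, b = c • b' :=
  exists_eq_smul_of_tmul_eq_tmul ha (by
    simpa using congrArg (TensorProduct.comm K V W) h)

theorem eq_of_tmul_eq_tmul {a a' : V} {b : W} (hb : b ≠ 0) (h : a ⊗ₜ[K] b = a' ⊗ₜ[K] b) :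
    a = a' := by
  obtain ⟨φ, hφ⟩ := Module.Projective.exists_dual_eq_one K hb
  have := congrArg (TensorProduct.rid K V ∘ LinearMap.lTensor V φ) h
  simpa [hφ] using this

end LinearAlgebra

/-- A linear map through which a bialgebra map factors, after a surjective bialgebra map, is a
bialgebra map. -/
theorem BialgHom.exists_of_linearMap {K A B C : Type*} [CommSemiring K] [Semiring A] [Semiring B]
    [Semiring C] [Bialgebra K A] [Bialgebra K B] [Bialgebra K C] (q : A →ₐc[K] B)
    (hq : Function.Surjective q) (p : A →ₐc[K] C) (F : B →ₗ[K] C) (hF : ∀ a, F (q a) = p a) :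
    ∃ f : B →ₐc[K] C, ∀ b, f b = F b := by
  have h1 : F 1 = 1 := by rw [← map_one q, hF, map_one]
  have hm : ∀ a b, F (a * b) = F a * F b := by
    intro a b
    obtain ⟨a, rfl⟩ := hq a
    obtain ⟨b, rfl⟩ := hq b
    rw [← map_mul, hF, hF, hF, map_mul]
  refine ⟨BialgHom.ofAlgHom (AlgHom.ofLinearMap F h1 hm) ?_ ?_, fun b => rfl⟩
  · ext b
    obtain ⟨a, rfl⟩ := hq b
    simp [hF]
  · ext b
    obtain ⟨a, rfl⟩ := hq b
    have e1 := CoalgHomClass.map_comp_comul_apply q a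
    have e2 := CoalgHomClass.map_comp_comul_apply p a
    simp only [AlgHom.comp_apply, Bialgebra.comulAlgHom_apply, AlgHom.ofLinearMap_apply, hF]
    rw [← e1, ← e2]
    -- Every element of `B` is some `q a`, whose coproduct is `(q ⊗ q)(Δ a)`; then `F ⊗ F` sends it
    -- to `(p ⊗ p)(Δ a)`.
    change (TensorProduct.map F F ∘ₗ TensorProduct.map (q : A →ₗ[K] B) (q : A →ₗ[K] B)) _ = _
    rw [← TensorProduct.map_comp]
    congr 2 <;> exact LinearMap.ext hF

/-! ### Products and comultiplication components in the smash coproduct. -/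

namespace SmashCoproduct

variable {k : Type u} {Γ : Type v} {H : Type w} [Field k] [Group Γ] [Group H]

theorem elt_mul_elt (r s : Γ) (f g : H → k) :
    (elt r f * elt s g : SmashCoproduct k Γ H) = elt (r * s) (f * g) := by
  change (MonoidAlgebra.single r (1 : k) ⊗ₜ[k] f : GroupTensorFun k Γ H) *
    (MonoidAlgebra.single s (1 : k) ⊗ₜ[k] g : GroupTensorFun k Γ H) = _
  rw [Algebra.TensorProduct.tmul_mul_tmul, MonoidAlgebra.single_mul_single, one_mul]
  rfl

variable [Fintype H] [DecidableEq H]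

theorem elt_eq_sum (r : Γ) (f : H → k) :
    (elt r f : SmashCoproduct k Γ H) = ∑ h, f h • e r h := by
  have : f = ∑ h, f h • (Pi.single h 1 : H → k) := by
    simpa using (Pi.basisFun k H).sum_repr f |>.symm
  conv_lhs => rw [this]
  exact (TensorProduct.tmul_sum _ _ _).trans
    (Finset.sum_congr rfl fun h _ => TensorProduct.tmul_smul _ _ _)

theorem elt_mul_e (r s : Γ) (f : H → k) (h : H) :
    (elt r f * e s h : SmashCoproduct k Γ H) = f h • e (r * s) h := by
  rw [elt_eq_sum, Finset.sum_mul, Finset.sum_eq_single h]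
  · simp [e_mul_e]
  · intro g _ hg
    simp [e_mul_e, hg]
  · simp

variable [MulDistribMulAction H Γ]

-- The idempotent `δ_m` in the first leg selects the summand `l = m⁻¹` of the coproduct, and `δ_n`
-- in the second keeps it only when `h = mn`. A single pure tensor is left, and this survives in
-- every Hopf quotient.
open Coalgebra in
theorem tmul_mul_comul_e (m n h : H) (r : Γ) :
    (e 1 m ⊗ₜ[k] e 1 n : SmashCoproduct k Γ H ⊗[k] SmashCoproduct k Γ H) * comul (e r h) =
      if h = m * n then e r m ⊗ₜ[k] e (m⁻¹ • r) n else 0 := by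
  rw [comul_e, Finset.mul_sum, Finset.sum_eq_single m⁻¹]
  · simp only [Algebra.TensorProduct.tmul_mul_tmul, e_mul_e, one_mul, inv_inv, if_true]
    by_cases hh : h = m * n
    · subst hh
      simp
    · have : n ≠ m⁻¹ * h := fun h' => hh (by rw [h', mul_inv_cancel_left])
      simp [hh, this]
  · intro l _ hl
    have : m ≠ l⁻¹ := fun h' => hl (by rw [h', inv_inv])
    simp [Algebra.TensorProduct.tmul_mul_tmul, e_mul_e, this]
  · simp

end SmashCoproduct

/-! ## The quotient map and the factorization attached to a compatible quotient datum -/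

namespace QuotientDatum.Twisted

variable {k : Type u} {Γ : Type v} {H : Type w} [Field k] [Group Γ] [Group H]
  [MulDistribMulAction H Γ] [Fintype H] [DecidableEq H] {D : QuotientDatum k Γ H}
  {j : NormalizedSection D.N}

theorem elt_eq_sum (x : Γ ⧸ D.N) (f : H → k) : (elt x f : D.Twisted j) = ∑ h, f h • e x h := by
  have : f = ∑ h, f h • (Pi.single h 1 : H → k) := by
    simpa using (Pi.basisFun k H).sum_repr f |>.symm
  conv_lhs => rw [this]
  exact (TensorProduct.tmul_sum _ _ _).trans
    (Finset.sum_congr rfl fun h _ => TensorProduct.tmul_smul _ _ _)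

variable (D j)

/-- The linear map `r # δ_h ↦ u(r) # δ_h Φ(r j(u(r))⁻¹)`. -/
noncomputable def quotientLinearMap : SmashCoproduct k Γ H →ₗ[k] D.Twisted j :=
  SmashCoproduct.basis.constr k fun p =>
    D.P (p.1 * (j.toFun (QuotientGroup.mk p.1))⁻¹) p.2 • e (QuotientGroup.mk p.1) p.2

theorem quotientLinearMap_e (r : Γ) (h : H) : quotientLinearMap D j (SmashCoproduct.e r h) =
    D.P (r * (j.toFun (QuotientGroup.mk r))⁻¹) h • e (QuotientGroup.mk r) h := by
  rw [← SmashCoproduct.basis_apply]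
  exact SmashCoproduct.basis.constr_basis k _ (r, h)

theorem quotientLinearMap_one : quotientLinearMap D j 1 = 1 := by
  rw [SmashCoproduct.one_eq, one_eq, map_sum]
  refine Finset.sum_congr rfl fun h _ => ?_
  rw [quotientLinearMap_e, QuotientGroup.mk_one, toFun_one, inv_one, mul_one, P_one, one_smul]

theorem quotientLinearMap_mul (a b : SmashCoproduct k Γ H) :
    quotientLinearMap D j (a * b) = quotientLinearMap D j a * quotientLinearMap D j b := by
  suffices h : (LinearMap.mul k (SmashCoproduct k Γ H)).compr₂ (quotientLinearMap D j) =
      (LinearMap.mul k (D.Twisted j)).compl₁₂ (quotientLinearMap D j) (quotientLinearMap D j) from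
    LinearMap.congr_fun (LinearMap.congr_fun h a) b
  refine SmashCoproduct.basis.ext fun p => SmashCoproduct.basis.ext fun p' => ?_
  obtain ⟨r, h⟩ := p
  obtain ⟨s, g⟩ := p'
  simp only [SmashCoproduct.basis_apply, LinearMap.compr₂_apply, LinearMap.mul_apply',
    LinearMap.compl₁₂_apply, SmashCoproduct.e_mul_e, quotientLinearMap_e, smul_mul_smul_comm,
    e_mul_e]
  by_cases hg : h = g
  · subst hg
    simp only [if_true, quotientLinearMap_e, smul_smul, QuotientGroup.mk_mul]
    congr 1
    have m1 := D.mem_mk j r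
    have m2 := D.mem_mk j s
    have m3 := D.mem_mul j (QuotientGroup.mk r) (QuotientGroup.mk s)
    -- Conjugation invariance of `Φ` allows `s j(u(s))⁻¹` to be conjugated by `j(u(r))`; the three
    -- arguments then telescope to `r s j(u(rs))⁻¹`.
    have m2' := D.normal.conj_mem _ m2 (j.toFun (QuotientGroup.mk r))
    rw [← D.P_conj m2 (j.toFun (QuotientGroup.mk r)), D.P_mul m1 m2',
      D.P_mul (D.N.mul_mem m1 m2') m3]
    congr 1
    group
  · simp [hg]

open Coalgebra

theorem counit_quotientLinearMap (a : SmashCoproduct k Γ H) :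
    counit (R := k) (quotientLinearMap D j a) = counit (R := k) a := by
  suffices h : counit ∘ₗ quotientLinearMap D j = counit from LinearMap.congr_fun h a
  refine SmashCoproduct.basis.ext fun p => ?_
  obtain ⟨r, h⟩ := p
  simp only [SmashCoproduct.basis_apply, LinearMap.comp_apply, quotientLinearMap_e, map_smul,
    counit_e, SmashCoproduct.counit_e]
  split_ifs with h1
  · simp [h1, D.P_apply_one (D.mem_mk j r)]
  · simp

theorem map_comul_quotientLinearMap (a : SmashCoproduct k Γ H) :
    TensorProduct.map (quotientLinearMap D j) (quotientLinearMap D j) (comul a) =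
      comul (quotientLinearMap D j a) := by
  suffices h : TensorProduct.map (quotientLinearMap D j) (quotientLinearMap D j) ∘ₗ comul =
      comul ∘ₗ quotientLinearMap D j from LinearMap.congr_fun h a
  refine SmashCoproduct.basis.ext fun p => ?_
  obtain ⟨r, h⟩ := p
  simp only [SmashCoproduct.basis_apply, LinearMap.comp_apply, quotientLinearMap_e, map_smul,
    comul_e, SmashCoproduct.comul_e, map_sum, TensorProduct.map_tmul, Finset.smul_sum]
  refine Finset.sum_congr rfl fun l _ => ?_
  rw [← TensorProduct.smul_tmul', TensorProduct.tmul_smul, smul_smul, smul_smul, act_mk]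
  congr 1
  have m1 := D.mem_mk j r
  have m2 := D.mem_act j l (QuotientGroup.mk r)
  rw [act_mk] at m2
  -- The cocycle identity splits the coefficient at `h = l⁻¹(lh)`: the factor at `l⁻¹` belongs to
  -- the first leg, the factor at `lh` merges with the coefficient of the comultiplication.
  have c := D.P_coc m1 l⁻¹ (l * h)
  rw [inv_mul_cancel_left, inv_inv] at c
  rw [c, mul_right_comm, D.P_mul (D.smul_mem l _ m1) m2, mul_comm]
  congr 2
  simp only [smul_mul', smul_inv']
  group

/-- The Hopf algebra map `r # f ↦ u(r) # f Φ(r j(u(r))⁻¹)`. -/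
noncomputable def quotientMap : SmashCoproduct k Γ H →ₐc[k] D.Twisted j :=
  BialgHom.ofAlgHom
    (AlgHom.ofLinearMap (quotientLinearMap D j) (quotientLinearMap_one D j)
      (quotientLinearMap_mul D j))
    (AlgHom.ext (counit_quotientLinearMap D j)) (AlgHom.ext (map_comul_quotientLinearMap D j))

theorem quotientMap_e (r : Γ) (h : H) : quotientMap D j (SmashCoproduct.e r h) =
    D.P (r * (j.toFun (QuotientGroup.mk r))⁻¹) h • e (QuotientGroup.mk r) h :=
  quotientLinearMap_e D j r h

theorem quotientMap_elt (r : Γ) (f : H → k) : quotientMap D j (SmashCoproduct.elt r f) =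
    elt (QuotientGroup.mk r)
      (f * (D.Φ ⟨r * (j.toFun (QuotientGroup.mk r))⁻¹, D.mem_mk j r⟩ : H → k)) := by
  rw [SmashCoproduct.elt_eq_sum, map_sum, elt_eq_sum]
  refine Finset.sum_congr rfl fun h _ => ?_
  rw [map_smul, quotientMap_e, smul_smul, Pi.mul_apply, P_eq]

theorem quotientMap_surjective : Function.Surjective (quotientMap D j) := by
  have : LinearMap.range (quotientLinearMap D j) = ⊤ := by
    rw [eq_top_iff, ← (basis (D := D) (j := j)).span_eq, Submodule.span_le]
    rintro _ ⟨⟨x, h⟩, rfl⟩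
    refine ⟨SmashCoproduct.e (j.toFun x) h, ?_⟩
    rw [quotientLinearMap_e, j.mk_toFun, mul_inv_cancel, P_one, one_smul, basis_apply]
  exact LinearMap.range_eq_top.1 this

variable {R : Type x} [Ring R] [Algebra k R]

/-- The linear map `x # δ_h ↦ ρ(j(x) # δ_h)`. -/
noncomputable def descendLinearMap (ρ : SmashCoproduct k Γ H →ₐ[k] R) : D.Twisted j →ₗ[k] R :=
  basis.constr k fun p => ρ (.e (j.toFun p.1) p.2)

variable (ρ : SmashCoproduct k Γ H →ₐ[k] R)

theorem descendLinearMap_e (x : Γ ⧸ D.N) (h : H) :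
    descendLinearMap D j ρ (e x h) = ρ (.e (j.toFun x) h) := by
  rw [← basis_apply]
  exact basis.constr_basis k _ (x, h)

variable {ρ D}

/-- Multiply the compatibility relation for `n` on the right by `ρ(r # δ_h)`. In this form it gives
the scalar cost of changing a representative within its coset of `N`. -/
theorem map_e_mul_of_mem_compatibleData (hD : D ∈ compatibleData ρ) {n : Γ} (hn : n ∈ D.N) (r : Γ)
    (h : H) : ρ (.e (n * r) h) = D.P n h • ρ (.e r h) := by
  have h1 := congrArg (· * ρ (.e r h)) (hD ⟨n, hn⟩)
  simpa [← map_mul, SmashCoproduct.elt_mul_e, P_eq] using h1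

theorem descendLinearMap_mul (hD : D ∈ compatibleData ρ) (a b : D.Twisted j) :
    descendLinearMap D j ρ (a * b) = descendLinearMap D j ρ a * descendLinearMap D j ρ b := by
  suffices h : (LinearMap.mul k (D.Twisted j)).compr₂ (descendLinearMap D j ρ) =
      (LinearMap.mul k R).compl₁₂ (descendLinearMap D j ρ) (descendLinearMap D j ρ) from
    LinearMap.congr_fun (LinearMap.congr_fun h a) b
  refine basis.ext fun p => basis.ext fun p' => ?_
  obtain ⟨x, h⟩ := p
  obtain ⟨y, g⟩ := p'
  simp only [basis_apply, LinearMap.compr₂_apply, LinearMap.mul_apply', LinearMap.compl₁₂_apply,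
    e_mul_e, descendLinearMap_e, ← map_mul, SmashCoproduct.e_mul_e]
  by_cases hg : h = g
  · subst hg
    simp only [if_true, map_smul, descendLinearMap_e]
    rw [← map_e_mul_of_mem_compatibleData hD (D.mem_mul j x y), inv_mul_cancel_right]
  · simp [hg]

/-- The algebra map `x # f ↦ ρ(j(x) # f)`. -/
noncomputable def descend (hD : D ∈ compatibleData ρ) : D.Twisted j →ₐ[k] R :=
  AlgHom.ofLinearMap (descendLinearMap D j ρ)
    (by
      rw [one_eq, map_sum, ← map_one ρ, SmashCoproduct.one_eq, map_sum]
      exact Finset.sum_congr rfl fun h _ => by rw [descendLinearMap_e, toFun_one])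
    (descendLinearMap_mul j hD)

theorem descend_elt (hD : D ∈ compatibleData ρ) (x : Γ ⧸ D.N) (f : H → k) :
    descend j hD (elt x f) = ρ (.elt (j.toFun x) f) := by
  rw [elt_eq_sum, SmashCoproduct.elt_eq_sum, map_sum, map_sum]
  refine Finset.sum_congr rfl fun h _ => ?_
  rw [map_smul, map_smul]
  exact congrArg _ (descendLinearMap_e D j ρ x h)

theorem descend_quotientMap (hD : D ∈ compatibleData ρ) (a : SmashCoproduct k Γ H) :
    descend j hD (quotientMap D j a) = ρ a := by
  suffices h : descendLinearMap D j ρ ∘ₗ quotientLinearMap D j = ρ.toLinearMap from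
    LinearMap.congr_fun h a
  refine SmashCoproduct.basis.ext fun p => ?_
  obtain ⟨r, h⟩ := p
  simp only [SmashCoproduct.basis_apply, LinearMap.comp_apply, quotientLinearMap_e, map_smul,
    descendLinearMap_e, AlgHom.toLinearMap_apply]
  rw [← map_e_mul_of_mem_compatibleData hD (D.mem_mk j r), inv_mul_cancel_right]

theorem isHopfFactorization_quotientMap (hD : D ∈ compatibleData ρ) :
    IsHopfFactorization ρ (quotientMap D j) (descend j hD) :=
  ⟨quotientMap_surjective D j, descend_quotientMap j hD⟩

end QuotientDatum.Twisted

/-! ## Quotients of `k[Γ] ⋊ k^H` -/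

section Quotient

open Coalgebra SmashCoproduct

variable {k : Type u} {Γ : Type v} {H : Type w} [Field k] [Group Γ] [Group H]
  [MulDistribMulAction H Γ] [Fintype H] [DecidableEq H] {M : Type y} [Ring M] [HopfAlgebra k M]
  (q : SmashCoproduct k Γ H →ₐc[k] M)

/-- The composite of the comultiplication of `M` with the multiplication by
`q(1 # δ_m) ⊗ q(1 # δ_n)`. -/
noncomputable def comulComponent (m n : H) : M →ₗ[k] M ⊗[k] M :=
  LinearMap.mulLeft k (q (e 1 m) ⊗ₜ[k] q (e 1 n)) ∘ₗ comul

theorem comulComponent_map_e (m n h : H) (r : Γ) : comulComponent q m n (q (e r h)) =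
    if h = m * n then q (e r m) ⊗ₜ[k] q (e (m⁻¹ • r) n) else 0 := by
  have h1 := congrArg (Algebra.TensorProduct.map (q : SmashCoproduct k Γ H →ₐ[k] M)
    (q : SmashCoproduct k Γ H →ₐ[k] M)) (tmul_mul_comul_e (k := k) m n h r)
  rw [map_mul, Algebra.TensorProduct.map_tmul] at h1
  rw [comulComponent, LinearMap.comp_apply, ← CoalgHomClass.map_comp_comul_apply]
  refine Eq.trans h1 ?_
  split_ifs
  · rfl
  · exact map_zero _

theorem comulComponent_map_e_mul (m n : H) (r : Γ) :
    comulComponent q m n (q (e r (m * n))) = q (e r m) ⊗ₜ[k] q (e (m⁻¹ • r) n) := by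
  rw [comulComponent_map_e, if_pos rfl]

theorem map_e_mul_map_e (r s : Γ) (h : H) : q (e r h) * q (e s h) = q (e (r * s) h) := by
  rw [← map_mul, e_mul_e, if_pos rfl]

variable {q}

/-- `q(r # δ_h)` divides `q(1 # δ_h)`, with cofactor `q(r⁻¹ # δ_h)`. -/
theorem map_e_ne_zero (hq : ∀ h : H, q (e 1 h) ≠ 0) (r : Γ) (h : H) : q (e r h) ≠ 0 := by
  intro h0
  apply hq h
  rw [← mul_inv_cancel r, ← map_e_mul_map_e, h0, zero_mul]

/-- The component `T_{1,h}` of the relation, with `c` absorbed in the second leg, reads `q(r # δ_1)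
⊗ q(r # δ_h) = q(1 # δ_1) ⊗ q(r # δ_h)`; cancel the nonzero second leg. -/
theorem map_e_one_eq_of_map_e_eq_smul (hq : ∀ h : H, q (e 1 h) ≠ 0) {r : Γ} {h : H} {c : k}
    (hr : q (e r h) = c • q (e 1 h)) : q (e r 1) = q (e 1 1) := by
  have h1 := congrArg (comulComponent q 1 h) hr
  have h2 := comulComponent_map_e_mul q 1 h r
  have h3 := comulComponent_map_e_mul q 1 h 1
  rw [one_mul] at h2 h3
  rw [map_smul, h2, h3, inv_one, one_smul, one_smul, ← TensorProduct.tmul_smul, ← hr] at h1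
  exact eq_of_tmul_eq_tmul (map_e_ne_zero hq r h) h1

/-- Since `g⁻¹ g = 1`, the component `T_{g⁻¹,g}` brings in `q(g.r # δ_g)`. Comparing second legs
makes it a multiple of `q(1 # δ_g)`, and the previous lemma returns from `δ_g` to `δ_1`. -/
theorem map_e_one_smul_eq (hq : ∀ h : H, q (e 1 h) ≠ 0) {r : Γ} (hr : q (e r 1) = q (e 1 1))
    (g : H) : q (e (g • r) 1) = q (e 1 1) := by
  have h1 := congrArg (comulComponent q g⁻¹ g) hr
  have h2 := comulComponent_map_e_mul q g⁻¹ g r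
  have h3 := comulComponent_map_e_mul q g⁻¹ g 1
  rw [inv_mul_cancel] at h2 h3
  rw [h2, h3, inv_inv, smul_one] at h1
  obtain ⟨c, hc⟩ := exists_eq_smul_of_tmul_eq_tmul' (map_e_ne_zero hq r g⁻¹) h1
  exact map_e_one_eq_of_map_e_eq_smul hq hc

/-- Here `T_{h,h⁻¹}` is used and the first legs are compared, one `h` at a time. -/
theorem exists_map_e_eq_smul (hq : ∀ h : H, q (e 1 h) ≠ 0) {r : Γ} (hr : q (e r 1) = q (e 1 1)) :
    ∃ f : H → k, ∀ h, q (e r h) = f h • q (e 1 h) := by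
  have : ∀ h, ∃ c : k, q (e r h) = c • q (e 1 h) := by
    intro h
    have h1 := congrArg (comulComponent q h h⁻¹) hr
    have h2 := comulComponent_map_e_mul q h h⁻¹ r
    have h3 := comulComponent_map_e_mul q h h⁻¹ 1
    rw [mul_inv_cancel] at h2 h3
    rw [h2, h3] at h1
    exact exists_eq_smul_of_tmul_eq_tmul (map_e_ne_zero hq _ _) h1
  choose f hf using this
  exact ⟨f, hf⟩

/-- This is the origin of the cocycle identity: `T_{l,h}` of the relation at `lh` has coefficient
`f(lh)` on one side and `f(l) f'(h)` on the other, in front of the same nonzero tensor. -/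
theorem mul_eq_of_map_e_eq_smul (hq : ∀ h : H, q (e 1 h) ≠ 0) {r : Γ} {f : H → k}
    (hf : ∀ h, q (e r h) = f h • q (e 1 h)) (l h : H) {f' : H → k}
    (hf' : ∀ h, q (e (l⁻¹ • r) h) = f' h • q (e 1 h)) : f (l * h) = f' h * f l := by
  have h1 := congrArg (comulComponent q l h) (hf (l * h))
  rw [map_smul, comulComponent_map_e_mul, comulComponent_map_e_mul, smul_one, hf, hf',
    ← TensorProduct.smul_tmul', TensorProduct.tmul_smul, smul_smul] at h1
  have h0 : q (e 1 l) ⊗ₜ[k] q (e 1 h) ≠ 0 := by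
    intro h0
    refine hq l (eq_of_tmul_eq_tmul (K := k) (hq h) ?_ : q (e 1 l) = 0)
    rw [h0, TensorProduct.zero_tmul]
  rw [mul_comm]
  exact (smul_left_injective k h0 h1).symm

theorem map_elt_eq_of_map_e_eq_smul {r : Γ} {f : H → k}
    (hf : ∀ h, q (e r h) = f h • q (e 1 h)) : q (elt r 1) = q (elt 1 f) := by
  rw [elt_eq_sum, elt_eq_sum, map_sum, map_sum]
  exact Finset.sum_congr rfl fun h _ => by rw [Pi.one_apply, one_smul, map_smul, hf]

/-- If the elements `r` with `q(r # δ_1) = q(1 # δ_1)` belong to the quotient datum `D`, and `D`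
is compatible with `q` on them, then the quotient map of `D` factors through `q`. -/
theorem exists_bialgHom_comp_eq_quotientMap (hq : ∀ h : H, q (e 1 h) ≠ 0) (hs : Function.Surjective q)
    (D : QuotientDatum k Γ H) (j : NormalizedSection D.N)
    (hD : ∀ r : Γ, q (e r 1) = q (e 1 1) →
      r ∈ D.N ∧ ∀ h, q (e r h) = D.P r h • q (e 1 h)) :
    ∃ f : M →ₐc[k] D.Twisted j, ∀ a, f (q a) = QuotientDatum.Twisted.quotientMap D j a := by
  have hli : LinearIndepOn k id (Set.range fun r : Γ => q (e r 1)) := by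
    refine linearIndepOn_of_map_eq_tmul_self (comulComponent q 1 1) ?_ ?_
    · rintro _ ⟨r, rfl⟩
      have := comulComponent_map_e_mul q 1 1 r
      rwa [one_mul, inv_one, one_smul] at this
    · rintro _ ⟨r, rfl⟩
      exact map_e_ne_zero hq r 1
  -- For `r` in the fibre of `t` under `r ↦ q(r # δ_1)`, the vectors `q(r # δ_h)` are multiples of
  -- `q(t # δ_h)`, with the same scalars `Φ(r t⁻¹)(h)` as their images in the target. One functional
  -- therefore handles the whole fibre.
  have hmod : ∀ (h : H) (t : Γ), ∃ L : M →ₗ[k] D.Twisted j, ∀ r, q (e r 1) = q (e t 1) →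
      L (q (e r h)) = QuotientDatum.Twisted.quotientMap D j (e r h) := by
    intro h t
    obtain ⟨φ, hφ⟩ := Module.Projective.exists_dual_eq_one k (map_e_ne_zero hq t h)
    refine ⟨φ.smulRight (QuotientDatum.Twisted.quotientMap D j (e t h)), fun r hr => ?_⟩
    have hn : q (e (r * t⁻¹) 1) = q (e 1 1) := by
      rw [← map_e_mul_map_e, hr, map_e_mul_map_e, mul_inv_cancel]
    obtain ⟨hN, hP⟩ := hD _ hn
    have hu : (QuotientGroup.mk r : Γ ⧸ D.N) = QuotientGroup.mk t := by
      have := (QuotientGroup.eq_one_iff (N := D.N) (r * t⁻¹)).2 hN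
      rwa [QuotientGroup.mk_mul, QuotientGroup.mk_inv, mul_inv_eq_one] at this
    have e1 : q (e r h) = D.P (r * t⁻¹) h • q (e t h) := by
      have := congrArg (· * q (e t h)) (hP h)
      simpa only [smul_mul_assoc, map_e_mul_map_e, inv_mul_cancel_right, one_mul] using this
    rw [e1, map_smul, LinearMap.smulRight_apply, hφ, one_smul,
      QuotientDatum.Twisted.quotientMap_e, QuotientDatum.Twisted.quotientMap_e, smul_smul, hu,
      D.P_mul hN (D.mem_mk j t)]
    congr 2
    group
  choose L hL using hmod
  have hext : ∀ h : H, ∃ β : M →ₗ[k] M →ₗ[k] D.Twisted j, ∀ r,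
      β (q (e r 1)) (q (e r h)) = QuotientDatum.Twisted.quotientMap D j (e r h) := by
    intro h
    -- Independence of the `q(r # δ_1)` allows a separate choice of `L h t` for each fibre, with
    -- `Function.invFun` choosing `t`; its values off the range are never used.
    obtain ⟨β, hβ⟩ := hli.exists_linearMap
      (fun a => L h (Function.invFun (fun r : Γ => q (e r 1)) a))
    refine ⟨β, fun r => ?_⟩
    rw [hβ _ ⟨r, rfl⟩]
    exact hL h _ r
      (Function.invFun_eq (f := fun r : Γ => q (e r 1)) ⟨r, rfl⟩).symm
  choose β hβ using hext
  -- On `q(r # δ_g)` only `T_{1,g}` is nonzero, with value `q(r # δ_1) ⊗ q(r # δ_g)`: the first leg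
  -- records the fibre and the second is the vector to be mapped.
  have hF : ∀ a, (∑ h : H, TensorProduct.lift (β h) ∘ₗ comulComponent q 1 h) (q a) =
      QuotientDatum.Twisted.quotientMap D j a := by
    intro a
    suffices h : (∑ h : H, TensorProduct.lift (β h) ∘ₗ comulComponent q 1 h) ∘ₗ
        (q : SmashCoproduct k Γ H →ₗ[k] M) = QuotientDatum.Twisted.quotientLinearMap D j from
      LinearMap.congr_fun h a
    refine SmashCoproduct.basis.ext fun p => ?_
    obtain ⟨r, g⟩ := p
    rw [SmashCoproduct.basis_apply, LinearMap.comp_apply, LinearMap.sum_apply,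
      Finset.sum_eq_single g]
    · have := comulComponent_map_e_mul q 1 g r
      rw [one_mul, inv_one, one_smul] at this
      refine Eq.trans ?_ (hβ g r)
      exact (congrArg (TensorProduct.lift (β g)) this).trans (TensorProduct.lift.tmul _ _)
    · intro h _ hh
      have := comulComponent_map_e q 1 h g r
      rw [one_mul, if_neg (Ne.symm hh)] at this
      exact (congrArg (TensorProduct.lift (β h)) this).trans (map_zero _)
    · simp
  obtain ⟨f, hf⟩ := BialgHom.exists_of_linearMap q hs (QuotientDatum.Twisted.quotientMap D j) _ hF
  exact ⟨f, fun a => (hf _).trans (hF a)⟩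

end Quotient

/-! ## Group elements acting as functions -/

section Scalar

open SmashCoproduct

variable {k : Type u} {Γ : Type v} {H : Type w} {R : Type x} [Field k] [Group Γ]
    [Group H] [Fintype H] [DecidableEq H] [MulDistribMulAction H Γ] [Ring R] [Algebra k R]
    {ρ : SmashCoproduct k Γ H →ₐ[k] R}

theorem map_e_ne_zero_of_injective (hρ : Function.Injective fun f : H → k => ρ (elt 1 f)) (h : H) :
    ρ (e 1 h) ≠ 0 := by
  intro h0
  have h1 : (Pi.single h 1 : H → k) = 0 := by
    apply hρ
    change ρ (e 1 h) = ρ (elt 1 0)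
    rw [h0, elt_eq_sum]
    simp
  simpa using congrFun h1 h

theorem map_elt_mul {r s : Γ} {f g : H → k} (hr : ρ (elt r 1) = ρ (elt 1 f))
    (hs : ρ (elt s 1) = ρ (elt 1 g)) : ρ (elt (r * s) 1) = ρ (elt 1 (f * g)) := by
  have := congrArg₂ (· * ·) hr hs
  simpa only [← map_mul, elt_mul_elt, one_mul] using this

/-- The elements `s # 1` and `1 # f` commute, so conjugation leaves the function unchanged. -/
theorem map_elt_conj {r : Γ} {f : H → k} (hr : ρ (elt r 1) = ρ (elt 1 f)) (s : Γ) :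
    ρ (elt (s * r * s⁻¹) 1) = ρ (elt 1 f) := by
  have := congrArg (ρ (elt s 1) * · * ρ (elt s⁻¹ 1)) hr
  simpa only [← map_mul, elt_mul_elt, one_mul, mul_one, mul_inv_cancel] using this

/-- Multiplying by `ρ(r⁻¹ # δ_h)` turns a zero `f h` into `ρ(1 # δ_h) = 0`. -/
theorem apply_ne_zero_of_map_elt_eq (hρ : Function.Injective fun f : H → k => ρ (elt 1 f)) {r : Γ}
    {f : H → k} (hr : ρ (elt r 1) = ρ (elt 1 f)) (h : H) : f h ≠ 0 := by
  intro h0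
  have := congrArg (· * ρ (e r⁻¹ h)) hr
  simp only [← map_mul, elt_mul_e, h0, zero_smul, map_zero, mul_inv_cancel, Pi.one_apply,
    one_smul] at this
  exact map_e_ne_zero_of_injective hρ h this

theorem map_elt_inv (hρ : Function.Injective fun f : H → k => ρ (elt 1 f)) {r : Γ}
    {f : H → k} (hr : ρ (elt r 1) = ρ (elt 1 f)) : ρ (elt r⁻¹ 1) = ρ (elt 1 f⁻¹) := by
  have := congrArg (ρ (elt r⁻¹ 1) * · * ρ (elt 1 f⁻¹)) hr
  have hf : f * f⁻¹ = 1 := funext fun h => mul_inv_cancel₀ (apply_ne_zero_of_map_elt_eq hρ hr h)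
  simp only [← map_mul, elt_mul_elt, one_mul, mul_one, inv_mul_cancel, hf] at this
  exact this.symm

/-- The subgroup of those `r ∈ Γ` with `ρ(r # 1) = ρ(1 # f)` for some `f ∈ k^H`. -/
def scalarSubgroup (hρ : Function.Injective fun f : H → k => ρ (elt 1 f)) : Subgroup Γ where
  carrier := {r | ∃ f : H → k, ρ (elt r 1) = ρ (elt 1 f)}
  mul_mem' := fun ⟨f, hf⟩ ⟨g, hg⟩ => ⟨f * g, map_elt_mul hf hg⟩
  one_mem' := ⟨1, rfl⟩
  inv_mem' := fun ⟨f, hf⟩ => ⟨f⁻¹, map_elt_inv hρ hf⟩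

variable (hρ : Function.Injective fun f : H → k => ρ (elt 1 f))

theorem mem_scalarSubgroup {r : Γ} :
    r ∈ scalarSubgroup hρ ↔ ∃ f : H → k, ρ (elt r 1) = ρ (elt 1 f) := Iff.rfl

theorem scalarSubgroup_normal : (scalarSubgroup hρ).Normal :=
  ⟨fun _ ⟨f, hf⟩ s => ⟨f, map_elt_conj hf s⟩⟩

variable (ρ) in
open Classical in
/-- A function `f` with `ρ(r # 1) = ρ(1 # f)`, when there is one. -/
noncomputable def scalarCoeff (r : Γ) : H → k :=
  -- The default 0 is harmless: `cocycleSubgroup` also requires the whole orbit to lie in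
  -- `scalarSubgroup`.
  if hr : ∃ f : H → k, ρ (elt r 1) = ρ (elt 1 f) then hr.choose else 0

variable {hρ}

theorem map_elt_scalarCoeff {r : Γ} (hr : r ∈ scalarSubgroup hρ) :
    ρ (elt r 1) = ρ (elt 1 (scalarCoeff ρ r)) := by
  rw [scalarCoeff, dif_pos ((mem_scalarSubgroup hρ).1 hr)]
  exact ((mem_scalarSubgroup hρ).1 hr).choose_spec

/-- Injectivity of `ρ` on `k^H` makes the function unique, so each identity between coefficients
reduces to exhibiting one function that represents the element. -/
theorem scalarCoeff_eq (hρ : Function.Injective fun f : H → k => ρ (elt 1 f)) {r : Γ} {f : H → k}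
    (hr : ρ (elt r 1) = ρ (elt 1 f)) : scalarCoeff ρ r = f :=
  hρ ((map_elt_scalarCoeff (hρ := hρ) ⟨f, hr⟩).symm.trans hr)

theorem scalarCoeff_one (hρ : Function.Injective fun f : H → k => ρ (elt 1 f)) :
    scalarCoeff ρ (1 : Γ) = 1 :=
  scalarCoeff_eq hρ rfl

theorem scalarCoeff_mul {r s : Γ} (hr : r ∈ scalarSubgroup hρ) (hs : s ∈ scalarSubgroup hρ) :
    scalarCoeff ρ (r * s) = scalarCoeff ρ r * scalarCoeff ρ s :=
  scalarCoeff_eq hρ (map_elt_mul (map_elt_scalarCoeff hr) (map_elt_scalarCoeff hs))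

theorem scalarCoeff_inv {r : Γ} (hr : r ∈ scalarSubgroup hρ) :
    scalarCoeff ρ r⁻¹ = (scalarCoeff ρ r)⁻¹ :=
  scalarCoeff_eq hρ (map_elt_inv hρ (map_elt_scalarCoeff hr))

theorem scalarCoeff_conj {r : Γ} (hr : r ∈ scalarSubgroup hρ) (s : Γ) :
    scalarCoeff ρ (s * r * s⁻¹) = scalarCoeff ρ r :=
  scalarCoeff_eq hρ (map_elt_conj (map_elt_scalarCoeff hr) s)

variable (hρ)

/-- The group morphism `Φ : N₀ → (k^H)ˣ` with `ρ(r # 1) = ρ(1 # Φ(r))`. -/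
noncomputable def scalarHom : scalarSubgroup hρ →* (H → k)ˣ :=
  MonoidHom.toHomUnits
    { toFun := fun r => scalarCoeff ρ (r : Γ)
      map_one' := scalarCoeff_one hρ
      map_mul' := fun r s => scalarCoeff_mul r.2 s.2 }

/-- The largest `H`-stable subgroup of `scalarSubgroup` on which the cocycle identity holds. -/
def cocycleSubgroup : Subgroup Γ where
  carrier := {r | (∀ g : H, g • r ∈ scalarSubgroup hρ) ∧ ∀ h g l : H,
    scalarCoeff ρ (g • r) (l * h) =
      scalarCoeff ρ ((l⁻¹ * g) • r) h * scalarCoeff ρ (g • r) l}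
  mul_mem' := by
    rintro r s ⟨hr, hr'⟩ ⟨hs, hs'⟩
    refine ⟨fun g => smul_mul' g r s ▸ mul_mem (hr g) (hs g), fun h g l => ?_⟩
    simp only [smul_mul', scalarCoeff_mul (hr _) (hs _), Pi.mul_apply]
    rw [hr', hs']
    ring
  one_mem' := by
    refine ⟨fun g => by rw [smul_one]; exact one_mem _, fun h g l => ?_⟩
    simp [scalarCoeff_one hρ]
  inv_mem' := by
    rintro r ⟨hr, hr'⟩
    refine ⟨fun g => smul_inv' g r ▸ inv_mem (hr g), fun h g l => ?_⟩
    simp only [smul_inv', scalarCoeff_inv (hr _), Pi.inv_apply]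
    rw [hr', mul_inv]

/-- The largest quotient datum in `E(ρ)`. -/
noncomputable def maximalDatum : QuotientDatum k Γ H where
  N := cocycleSubgroup hρ
  normal := by
    refine ⟨?_⟩
    rintro r ⟨hr, hr'⟩ s
    refine ⟨fun g => ?_, fun h g l => ?_⟩
    · rw [smul_mul', smul_mul', smul_inv']
      exact (scalarSubgroup_normal hρ).conj_mem _ (hr g) _
    · simp only [smul_mul', smul_inv', scalarCoeff_conj (hr _)]
      exact hr' h g l
  smul_mem := by
    rintro a r ⟨hr, hr'⟩
    refine ⟨fun g => by rw [smul_smul]; exact hr _, fun h g l => ?_⟩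
    -- Stability holds because the conditions range over the whole orbit: acting by `a` only
    -- replaces `g` by `g * a`.
    simp only [smul_smul, mul_assoc]
    exact hr' h (g * a) l
  Φ := (scalarHom hρ).comp (Subgroup.inclusion fun r hr => one_smul H r ▸ hr.1 1)
  Φ_mul := by
    rintro ⟨r, hr, hr'⟩ l h
    -- The case `g = 1` of the orbit condition is the cocycle identity for `Φ`.
    have := hr' h 1 l
    rwa [one_smul, mul_one] at this
  Φ_conj := by
    rintro ⟨r, hr, hr'⟩ s
    have hr₀ : r ∈ scalarSubgroup hρ := one_smul H r ▸ hr 1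
    exact Units.ext (scalarCoeff_conj hr₀ s).symm

theorem coe_maximalDatum_Φ (r : (maximalDatum hρ).N) :
    ((maximalDatum hρ).Φ r : H → k) = scalarCoeff ρ (r : Γ) := rfl

theorem mem_scalarSubgroup_of_mem_maximalDatum {r : Γ} (hr : r ∈ (maximalDatum hρ).N) :
    r ∈ scalarSubgroup hρ := one_smul H r ▸ hr.1 1

theorem maximalDatum_mem_compatibleData : maximalDatum hρ ∈ compatibleData ρ := fun r =>
  map_elt_scalarCoeff (mem_scalarSubgroup_of_mem_maximalDatum hρ r.2)

/-! ### Finality of the factorization given by the maximal datum. -/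

variable (j : NormalizedSection (maximalDatum hρ).N)

/-- If `q(r # δ_1) = q(1 # δ_1)`, each `g.r` acts through a function already in `M`, and applying
`ψ` shows that this function is its coefficient under `ρ`. The cocycle identity, which `ρ` alone
would not give, comes from the comultiplication of `M`. -/
theorem exists_bialgHom_of_isHopfFactorization {M : Type y} [Ring M] [HopfAlgebra k M]
    {q : SmashCoproduct k Γ H →ₐc[k] M} {ψ : M →ₐ[k] R} (hq : IsHopfFactorization ρ q ψ) :
    ∃ f : M →ₐc[k] (maximalDatum hρ).Twisted j,
      ∀ a, f (q a) = QuotientDatum.Twisted.quotientMap (maximalDatum hρ) j a := by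
  have hq0 : ∀ h : H, q (e 1 h) ≠ 0 := fun h h0 =>
    map_e_ne_zero_of_injective hρ h (by rw [← hq.factors, h0, map_zero])
  have hcoeff : ∀ {r : Γ} {f : H → k}, (∀ h, q (e r h) = f h • q (e 1 h)) →
      ρ (elt r 1) = ρ (elt 1 f) := fun hf => by
    rw [← hq.factors, map_elt_eq_of_map_e_eq_smul hf, hq.factors]
  refine exists_bialgHom_comp_eq_quotientMap hq0 hq.surjective _ j fun r hr => ?_
  have hsmul := map_e_one_smul_eq hq0 hr
  have hspec : ∀ g h : H, q (e (g • r) h) = scalarCoeff ρ (g • r) h • q (e 1 h) := by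
    intro g
    obtain ⟨f, hf⟩ := exists_map_e_eq_smul hq0 (hsmul g)
    rwa [scalarCoeff_eq hρ (hcoeff hf)]
  have hmem : r ∈ (maximalDatum hρ).N := by
    refine ⟨fun g => ⟨_, hcoeff (hspec g)⟩, fun h g l => ?_⟩
    refine mul_eq_of_map_e_eq_smul hq0 (hspec g) l h fun h' => ?_
    rw [smul_smul]
    exact hspec _ h'
  refine ⟨hmem, fun h => ?_⟩
  have := hspec 1 h
  rw [one_smul] at this
  rw [← QuotientDatum.P_eq _ r hmem, coe_maximalDatum_Φ]
  exact this

theorem isHopfImage_maximalDatum : IsHopfImage.{u, _, x, _, y} ρ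
    (QuotientDatum.Twisted.quotientMap (maximalDatum hρ) j)
    (QuotientDatum.Twisted.descend j (maximalDatum_mem_compatibleData hρ)) where
  isHopfFactorization :=
    QuotientDatum.Twisted.isHopfFactorization_quotientMap j (maximalDatum_mem_compatibleData hρ)
  existsUnique := by
    intro M _ _ q ψ hq
    obtain ⟨f, hf⟩ := exists_bialgHom_of_isHopfFactorization hρ j hq
    -- Compatibility with the maps to `R` and uniqueness are both checked on elements `q a`, which
    -- exhaust `M`.
    refine ⟨f, ⟨hf, fun m => ?_⟩, fun f' hf' => ?_⟩
    · obtain ⟨a, rfl⟩ := hq.surjective m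
      rw [hf, QuotientDatum.Twisted.descend_quotientMap, hq.factors]
    · ext m
      obtain ⟨a, rfl⟩ := hq.surjective m
      rw [hf, hf'.1]

end Scalar

theorem corollary4p4 {k : Type u} {Γ : Type v} {H : Type w} {R : Type x} [Field k] [Group Γ]
    [Group H] [Fintype H] [DecidableEq H] [MulDistribMulAction H Γ] [Ring R] [Algebra k R]
    (ρ : SmashCoproduct k Γ H →ₐ[k] R)
    (hρ : Function.Injective fun f : H → k => ρ (SmashCoproduct.elt 1 f)) :
    ∃ N₀ : Subgroup Γ, N₀.Normal ∧
      (∀ r : Γ, r ∈ N₀ ↔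
        ∃ f : H → k, ρ (SmashCoproduct.elt r 1) = ρ (SmashCoproduct.elt 1 f)) ∧
      ∃ Φ : N₀ →* (H → k)ˣ,
        (∀ r : N₀, ρ (SmashCoproduct.elt (r : Γ) 1) = ρ (SmashCoproduct.elt 1 (Φ r : H → k))) ∧
        (∀ Φ' : N₀ →* (H → k)ˣ, (∀ r : N₀,
          ρ (SmashCoproduct.elt (r : Γ) 1) = ρ (SmashCoproduct.elt 1 (Φ' r : H → k))) → Φ' = Φ) ∧
        ∃ D : QuotientDatum k Γ H,
          (∀ r : Γ, r ∈ D.N ↔ r ∈ N₀ ∧ ∃ hr : ∀ h : H, h • r ∈ N₀, ∀ h g l : H,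
            (Φ ⟨g • r, hr g⟩ : H → k) (l * h) =
              (Φ ⟨(l⁻¹ * g) • r, hr (l⁻¹ * g)⟩ : H → k) h * (Φ ⟨g • r, hr g⟩ : H → k) l) ∧
          (∀ (r : Γ) (hr : r ∈ D.N) (hr₀ : r ∈ N₀), D.Φ ⟨r, hr⟩ = Φ ⟨r, hr₀⟩) ∧
          D ∈ compatibleData ρ ∧
          ∀ j : NormalizedSection D.N,
            ∃ (q : SmashCoproduct k Γ H →ₐc[k] D.Twisted j) (ρ' : D.Twisted j →ₐ[k] R),
              (∀ (r : Γ) (f : H → k), q (SmashCoproduct.elt r f) =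
                QuotientDatum.Twisted.elt (QuotientGroup.mk r)
                  (f * (D.Φ ⟨r * (j.toFun (QuotientGroup.mk r))⁻¹, D.mem_mk j r⟩ : H → k))) ∧
              (∀ (x : Γ ⧸ D.N) (f : H → k), ρ' (QuotientDatum.Twisted.elt x f) =
                ρ (SmashCoproduct.elt (j.toFun x) f)) ∧
              IsHopfImage.{u, _, x, _, y} ρ q ρ' := by
  refine ⟨scalarSubgroup hρ, scalarSubgroup_normal hρ, fun r => Iff.rfl, scalarHom hρ,
    fun r => map_elt_scalarCoeff r.2, fun Φ' hΦ' => ?_, maximalDatum hρ, fun r => ?_,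
    fun r hr hr₀ => rfl, maximalDatum_mem_compatibleData hρ, fun j => ?_⟩
  · exact MonoidHom.ext fun r => Units.ext (scalarCoeff_eq hρ (hΦ' r)).symm
  · exact ⟨fun hr => ⟨mem_scalarSubgroup_of_mem_maximalDatum hρ hr, hr.1, hr.2⟩,
      fun hr => ⟨hr.2.1, hr.2.2⟩⟩
  · exact ⟨QuotientDatum.Twisted.quotientMap _ j,
      QuotientDatum.Twisted.descend j (maximalDatum_mem_compatibleData hρ),
      QuotientDatum.Twisted.quotientMap_elt _ j,
      QuotientDatum.Twisted.descend_elt j (maximalDatum_mem_compatibleData hρ),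
      isHopfImage_maximalDatum hρ j⟩
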